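/- **Theorem (Optimal control policy).** Let $n,m,p\ge 0$, $M\ge 1$, $T\ge 0$ be integers and consider $$X_{t+1}=AX_t+BU_t+W_t,\qquad Y_t=CX_t+\nu_t,\qquad t=0,1,\dots,$$ with $X_t\in\mathbb R^n$, $U_t\in\mathbb R^m$, $Y_t\in\mathbb R^p$, where $X_0\sim\mathcal N(\mu_0,\Sigma_x)$, $W_t\sim\mathcal N(0,\mathcal W)$, $\nu_t\sim\mathcal N(0,\mathcal V)$ $(t\ge0)$ are mutually independent. There are $M$ quantizers; the $i$-th one is a Borel map $g_i:\mathbb R^p\to\mathcal Q^i$ into a finite set $\mathcal Q^i\subset\mathbb R^p$, with delay $d_i\in\mathbb N_0$ (for instance $d_i=\lceil \log_2\ell_i/r_b\rceil$ for $\ell_i$ levels and channel bit rate $r_b$) and cost $\lambda_i\ge0$. At each time $t$ one quantizer $i$ is selected, which is encoded by $\theta_t=e_i\in\{0,1\}^M$; it quantizes the innovation $$\xi_t=Y_t-\mathsf E[Y_t\mid Y_0,\dots,Y_{t-1},U_0,\dots,U_{t-1}],$$ and the pair $(g_i(\xi_t),i)$ reaches the controller at time $t+d_i$. Let $\hat O_t$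 be the set of the pairs that arrive at time $t$. Admissible policies are $U_t=\gamma^u_t(\mathfrak I^c_t)$ and $\theta_t=\gamma^\theta_t(\hat O_0,\dots,\hat O_{t-1},\theta_0,\dots,\theta_{t-1})$ with measurable $\gamma^u_t,\gamma^\theta_t$, where $\mathfrak I^c_t=(\hat O_0,\dots,\hat O_t,U_0,\dots,U_{t-1})$. Let $Q_1,Q_2\succeq0$, $R\succ0$, $\Lambda=(\lambda_1,\dots,\lambda_M)^{\mathsf T}$, and for $0\le k\le T$ put $$J_k=\mathsf E\Big[\sum_{t=k}^{T-1}\big(X_t^{\mathsf T}Q_1X_t+U_t^{\mathsf T}RU_t+\theta_t^{\mathsf T}\Lambda\big)+X_T^{\mathsf T}Q_2X_T\Big],\qquad J=J_0 .$$ Given the policies used before time $k$, let $V_k$ be the infimum of $J_k$ over the policies $\gamma^u_t,\gamma^\theta_t$, $t\ge k$. Define $P_T=Q_2$ and, for $k=T-1,\dots,0$, $$L_k=(R+B^{\mathsf T}P_{k+1}B)^{-1}B^{\mathsf T}P_{k+1}A,\qquad P_k=Q_1+A^{\mathsf T}P_{k+1}A-L_k^{\mathsf T}(R+B^{\mathsf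 T}P_{k+1}B)L_k ,$$ $N_k=L_k^{\mathsf T}(R+B^{\mathsf T}P_{k+1}B)L_k$, $r_k=\sum_{t=k}^{T-1}\operatorname{tr}(P_{t+1}\mathcal W)$ and $e_t=X_t-\mathsf E[X_t\mid\mathfrak I^c_t]$. (Thus $L_k$ and $P_k$ depend only on $A,B,Q_1,Q_2,R,T$, and not on the quantizers or on the selection policy.) Then: 1. $P_k\succeq0$ for $k\le T$, and $R+B^{\mathsf T}P_{k+1}B\succ0$ for $k<T$. 2. For $k<T$ and any policies used before $k$, the value function satisfies the dynamic programming equation $$V_k=\min_{\gamma^u_k,\gamma^\theta_k}\Big(\mathsf E\big[X_k^{\mathsf T}Q_1X_k+U_k^{\mathsf T}RU_k+\theta_k^{\mathsf T}\Lambda\big]+V_{k+1}\Big),$$ and the minimum is attained. For any fixed $\gamma^\theta_k$, a control policy $\gamma^u_k$ minimizes the expression on the right if and only if $$U_k=-L_k\,\mathsf E[X_k\mid\mathfrak I^c_k]\quad\text{almost surely.}\qquad(*)$$ 3. For every selection policy $\gamma^\theta$, there is an admissible control policy that satisfies $(*)$ for all $k<T$; and a control policy minimizes $J(\cdot,\gamma^\theta)$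 if and only if it satisfies $(*)$ for all $k<T$. There is a pair $(\gamma^{u*},\gamma^{\theta*})$ that minimizes $J$ over all admissible pairs, and the control policy of every such pair satisfies $(*)$ for all $k<T$. 4. For $k\le T$ and any policies used before $k$, the infimum $V_k$ is finite and attained, and $$V_k=\mathsf E[X_k^{\mathsf T}P_kX_k]+C_k+r_k,\qquad C_k=\min_{\{\gamma^\theta_t\}_{t\ge k}}\mathsf E\Big[\sum_{t=k}^{T-1}\big(e_t^{\mathsf T}N_te_t+\theta_t^{\mathsf T}\Lambda\big)\Big],$$ where the minimum in $C_k$ is attained and $C_k$ does not depend on the control policy (it depends only on the selection policy used before $k$). -/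

import Mathlib

open MeasureTheory ProbabilityTheory Matrix
open scoped ENNReal NNReal

namespace QFLQG

/-- The linear-quadratic data of the control problem: the dynamics `A`, `B` and the weights
`Q₁, Q₂ ⪰ 0`, `R ≻ 0`. -/
structure Plant (n m : ℕ) where
  A : Matrix (Fin n) (Fin n) ℝ
  B : Matrix (Fin n) (Fin m) ℝ
  Q₁ : Matrix (Fin n) (Fin n) ℝ
  Q₂ : Matrix (Fin n) (Fin n) ℝ
  R : Matrix (Fin m) (Fin m) ℝ
  posSemidef_Q₁ : Q₁.PosSemidef
  posSemidef_Q₂ : Q₂.PosSemidef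
  posDef_R : R.PosDef

namespace Plant

variable {n m : ℕ}

/-- The weight `R + Bᵀ P B`. -/
def weight (S : Plant n m) (P : Matrix (Fin n) (Fin n) ℝ) : Matrix (Fin m) (Fin m) ℝ :=
  S.R + S.Bᵀ * P * S.B

/-- The gain `(R + Bᵀ P B)⁻¹ Bᵀ P A`. -/
noncomputable def gainOf (S : Plant n m) (P : Matrix (Fin n) (Fin n) ℝ) :
    Matrix (Fin m) (Fin n) ℝ :=
  (S.weight P)⁻¹ * S.Bᵀ * P * S.A

/-- The Riccati matrix with `j` steps to go. -/
noncomputable def riccatiAux (S : Plant n m) : ℕ → Matrix (Fin n) (Fin n) ℝ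
  | 0 => S.Q₂
  | j + 1 =>
      S.Q₁ + S.Aᵀ * riccatiAux S j * S.A
        - (S.gainOf (riccatiAux S j))ᵀ * S.weight (riccatiAux S j) * S.gainOf (riccatiAux S j)

/-- The Riccati matrix `P_k` for the horizon `T` (meaningful for `k ≤ T`). -/
noncomputable def riccati (S : Plant n m) (T k : ℕ) : Matrix (Fin n) (Fin n) ℝ :=
  S.riccatiAux (T - k)

/-- The gain `L_k = (R + Bᵀ P_{k+1} B)⁻¹ Bᵀ P_{k+1} A`. -/
noncomputable def gain (S : Plant n m) (T k : ℕ) : Matrix (Fin m) (Fin n) ℝ :=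
  S.gainOf (S.riccati T (k + 1))

/-- The matrix `N_k = L_kᵀ (R + Bᵀ P_{k+1} B) L_k`. -/
noncomputable def errorWeight (S : Plant n m) (T k : ℕ) : Matrix (Fin n) (Fin n) ℝ :=
  (S.gain T k)ᵀ * S.weight (S.riccati T (k + 1)) * S.gain T k

theorem riccati_terminal (S : Plant n m) (T : ℕ) : S.riccati T T = S.Q₂ := by
  simp [riccati, riccatiAux]

theorem riccati_step (S : Plant n m) {T k : ℕ} (hk : k < T) :
    S.riccati T k = S.Q₁ + S.Aᵀ * S.riccati T (k + 1) * S.A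
      - (S.gain T k)ᵀ * (S.R + S.Bᵀ * S.riccati T (k + 1) * S.B) * S.gain T k := by
  have h : T - k = (T - (k + 1)) + 1 := by omega
  rw [riccati, h, riccatiAux]
  rfl

end Plant

/-- A quantizer on `ℝᵖ`: a Borel map into a finite set of quantized values. Its partition
consists of the preimages of the quantized values. -/
structure Quantizer (p : ℕ) where
  range : Finset (Fin p → ℝ)
  quantize : (Fin p → ℝ) → range
  measurable_quantize : Measurable quantize

/-- All the data of the quantized-feedback LQG problem: the plant, the output matrix, the
statistics of the noises and of the initial state, and the `M` available quantizers with
their delays and their prices. -/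
structure System (n m p M : ℕ) extends Plant n m where
  C : Matrix (Fin p) (Fin n) ℝ
  covW : Matrix (Fin n) (Fin n) ℝ
  covV : Matrix (Fin p) (Fin p) ℝ
  mean₀ : Fin n → ℝ
  cov₀ : Matrix (Fin n) (Fin n) ℝ
  posSemidef_covW : covW.PosSemidef
  posSemidef_covV : covV.PosSemidef
  posSemidef_cov₀ : cov₀.PosSemidef
  quantizer : Fin M → Quantizer p
  delay : Fin M → ℕ
  price : Fin M → ℝ≥0

/-- What arrives at the controller at one time: for each quantizer `i`, either nothing, or a
quantized value labelled with `i`. This is a finite set. -/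
def Obs {n m p M : ℕ} (S : System n m p M) : Type :=
  (i : Fin M) → Option (S.quantizer i).range

instance {n m p M : ℕ} (S : System n m p M) : MeasurableSpace (Obs S) := ⊤

/-- The controller's information at time `t`: the arrivals at the times `0, …, t` and the
controls applied at the times `0, …, t - 1`. -/
abbrev CtrlInfo {n m p M : ℕ} (S : System n m p M) (t : ℕ) : Type :=
  (Fin (t + 1) → Obs S) × (Fin t → Fin m → ℝ)

/-- The quantizer-selector's information at time `t`: the arrivals and the selected quantizers
at the times `0, …, t - 1`. -/
abbrev SelInfo {n m p M : ℕ} (S : System n m p M) (t : ℕ) : Type :=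
  (Fin t → Obs S) × (Fin t → Fin M)

/-- An admissible control policy. -/
structure CtrlPolicy {n m p M : ℕ} (S : System n m p M) where
  act : (t : ℕ) → CtrlInfo S t → Fin m → ℝ
  measurable_act : ∀ t, Measurable (act t)

/-- An admissible quantizer-selection policy. Exactly one quantizer is used at each time, and
the one-hot vector `θ_t` is represented by the index of that quantizer. -/
structure SelPolicy {n m p M : ℕ} (S : System n m p M) where
  act : (t : ℕ) → SelInfo S t → Fin M
  measurable_act : ∀ t, Measurable (act t)

/-- The two control policies coincide at the times before `k`. -/
def CtrlPolicy.AgreeBefore {n m p M : ℕ} {S : System n m p M} (k : ℕ) (γ γ' : CtrlPolicy S) :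
    Prop :=
  ∀ t < k, γ'.act t = γ.act t

/-- The two selection policies coincide at the times before `k`. -/
def SelPolicy.AgreeBefore {n m p M : ℕ} {S : System n m p M} (k : ℕ) (γ γ' : SelPolicy S) :
    Prop :=
  ∀ t < k, γ'.act t = γ.act t

/-- The primitive random variables on a probability space: the initial state, the process noise
and the measurement noise, Gaussian with the prescribed statistics and mutually independent. -/
structure Noise {n m p M : ℕ} (S : System n m p M) {Ω : Type*} [MeasurableSpace Ω]
    (μ : Measure Ω) where
  X₀ : Ω → Fin n → ℝ
  W : ℕ → Ω → Fin n → ℝ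
  V : ℕ → Ω → Fin p → ℝ
  measurable_X₀ : Measurable X₀
  measurable_W : ∀ t, Measurable (W t)
  measurable_V : ∀ t, Measurable (V t)
  law_X₀ : HasLaw (fun ω => WithLp.toLp 2 (X₀ ω))
    (multivariateGaussian (WithLp.toLp 2 S.mean₀) S.cov₀) μ
  law_W : ∀ t, HasLaw (fun ω => WithLp.toLp 2 (W t ω)) (multivariateGaussian 0 S.covW) μ
  law_V : ∀ t, HasLaw (fun ω => WithLp.toLp 2 (V t ω)) (multivariateGaussian 0 S.covV) μ
  indep : iIndep (fun i : Unit ⊕ (ℕ ⊕ ℕ) => match i with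
    | .inl _ => MeasurableSpace.comap X₀ inferInstance
    | .inr (.inl t) => MeasurableSpace.comap (W t) inferInstance
    | .inr (.inr t) => MeasurableSpace.comap (V t) inferInstance) μ

section ClosedLoop

variable {n m p M : ℕ} {S : System n m p M} {Ω : Type*} [MeasurableSpace Ω] {μ : Measure Ω}

/-! The closed loop driven by a control policy `γu` and a selection policy `γθ`. -/

mutual

/-- The state: `X_0` is given and `X_{t+1} = A X_t + B U_t + W_t`. -/
noncomputable def state (N : Noise S μ) (γu : CtrlPolicy S) (γθ : SelPolicy S)
    (t : ℕ) (ω : Ω) : Fin n → ℝ :=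
  match t with
  | 0 => N.X₀ ω
  | t + 1 => S.A *ᵥ state N γu γθ t ω + S.B *ᵥ input N γu γθ t ω + N.W t ω
termination_by (t, 0)

/-- The measured output `Y_t = C X_t + ν_t`. -/
noncomputable def output (N : Noise S μ) (γu : CtrlPolicy S) (γθ : SelPolicy S)
    (t : ℕ) (ω : Ω) : Fin p → ℝ :=
  S.C *ᵥ state N γu γθ t ω + N.V t ω
termination_by (t, 1)

/-- The innovation `ξ_t = Y_t - E[Y_t | Y_0, …, Y_{t-1}, U_0, …, U_{t-1}]`. -/
noncomputable def innovation (N : Noise S μ) (γu : CtrlPolicy S) (γθ : SelPolicy S)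
    (t : ℕ) (ω : Ω) : Fin p → ℝ :=
  output N γu γθ t ω -
    (μ[fun ω' => output N γu γθ t ω' | MeasurableSpace.comap
      (fun ω' => fun s : Fin t => (output N γu γθ s ω', input N γu γθ s ω'))
      inferInstance]) ω
termination_by (t, 2)

/-- The index of the quantizer used at time `t`. -/
noncomputable def selection (N : Noise S μ) (γu : CtrlPolicy S) (γθ : SelPolicy S)
    (t : ℕ) (ω : Ω) : Fin M :=
  γθ.act t
    (fun s : Fin t => arrival N γu γθ s ω, fun s : Fin t => selection N γu γθ s ω)
termination_by (t, 2)

/-- What arrives at the controller at time `t`: if the `i`-th quantizer was used at time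
`t - d_i ≥ 0`, then the value that it gave to the innovation at that time arrives, labelled
with `i`. -/
noncomputable def arrival (N : Noise S μ) (γu : CtrlPolicy S) (γθ : SelPolicy S)
    (t : ℕ) (ω : Ω) : Obs S :=
  fun i =>
    if S.delay i ≤ t ∧ selection N γu γθ (t - S.delay i) ω = i then
      some ((S.quantizer i).quantize (innovation N γu γθ (t - S.delay i) ω))
    else none
termination_by (t, 3)
decreasing_by all_goals (simp only [Prod.lex_def]; omega)

/-- The control `U_t`, computed by the policy from the controller's information. -/
noncomputable def input (N : Noise S μ) (γu : CtrlPolicy S) (γθ : SelPolicy S)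
    (t : ℕ) (ω : Ω) : Fin m → ℝ :=
  γu.act t
    (fun s : Fin (t + 1) => arrival N γu γθ s ω, fun s : Fin t => input N γu γθ s ω)
termination_by (t, 4)
decreasing_by all_goals (simp only [Prod.lex_def]; omega)

end

/-- The controller's information at time `t`, as a random variable. -/
noncomputable def ctrlInfo (N : Noise S μ) (γu : CtrlPolicy S) (γθ : SelPolicy S) (t : ℕ) :
    Ω → CtrlInfo S t :=
  fun ω => (fun s => arrival N γu γθ s ω, fun s => input N γu γθ s ω)

/-- The state estimate `E[X_t | I^c_t]` of the controller. -/
noncomputable def estimate (N : Noise S μ) (γu : CtrlPolicy S) (γθ : SelPolicy S) (t : ℕ) :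
    Ω → Fin n → ℝ :=
  μ[state N γu γθ t | MeasurableSpace.comap (ctrlInfo N γu γθ t) inferInstance]

/-- The estimation error `e_t = X_t - E[X_t | I^c_t]`. -/
noncomputable def estError (N : Noise S μ) (γu : CtrlPolicy S) (γθ : SelPolicy S) (t : ℕ) :
    Ω → Fin n → ℝ :=
  state N γu γθ t - estimate N γu γθ t

/-- The running cost `X_tᵀ Q₁ X_t + U_tᵀ R U_t + θ_tᵀ Λ`. -/
noncomputable def stageCost (N : Noise S μ) (γu : CtrlPolicy S) (γθ : SelPolicy S) (t : ℕ)
    (ω : Ω) : ℝ :=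
  state N γu γθ t ω ⬝ᵥ S.Q₁ *ᵥ state N γu γθ t ω
    + input N γu γθ t ω ⬝ᵥ S.R *ᵥ input N γu γθ t ω
    + S.price (selection N γu γθ t ω)

/-- The expected cost from time `k` on,
`E[∑_{t=k}^{T-1} (X_tᵀ Q₁ X_t + U_tᵀ R U_t + θ_tᵀ Λ) + X_Tᵀ Q₂ X_T]`; the random variable is
nonnegative. -/
noncomputable def costFrom (N : Noise S μ) (T k : ℕ) (γu : CtrlPolicy S) (γθ : SelPolicy S) :
    ℝ≥0∞ :=
  ∫⁻ ω, ENNReal.ofReal (∑ t ∈ Finset.Ico k T, stageCost N γu γθ t ω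
    + state N γu γθ T ω ⬝ᵥ S.Q₂ *ᵥ state N γu γθ T ω) ∂μ

/-- The performance index `J`. -/
noncomputable def cost (N : Noise S μ) (T : ℕ) (γu : CtrlPolicy S) (γθ : SelPolicy S) : ℝ≥0∞ :=
  costFrom N T 0 γu γθ

/-- The value function `V_k`: the optimal expected cost from time `k` on, when `γu` and `γθ`
have been used before `k`. -/
noncomputable def value (N : Noise S μ) (T k : ℕ) (γu : CtrlPolicy S) (γθ : SelPolicy S) :
    ℝ≥0∞ :=
  sInf {v | ∃ γu' γθ', CtrlPolicy.AgreeBefore k γu γu' ∧ SelPolicy.AgreeBefore k γθ γθ' ∧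
    v = costFrom N T k γu' γθ'}

/-- The quantity minimized in the dynamic programming equation,
`E[X_kᵀ Q₁ X_k + U_kᵀ R U_k + θ_kᵀ Λ] + V_{k+1}`. It involves the policies up to time `k`
only. -/
noncomputable def bellman (N : Noise S μ) (T k : ℕ) (γu : CtrlPolicy S) (γθ : SelPolicy S) :
    ℝ≥0∞ :=
  ∫⁻ ω, ENNReal.ofReal (stageCost N γu γθ k ω) ∂μ + value N T (k + 1) γu γθ

/-- `E[∑_{t=k}^{T-1} (e_tᵀ N_t e_t + θ_tᵀ Λ)]`; the random variable is nonnegative. -/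
noncomputable def selCost (N : Noise S μ) (T k : ℕ) (γu : CtrlPolicy S) (γθ : SelPolicy S) :
    ℝ≥0∞ :=
  ∫⁻ ω, ENNReal.ofReal (∑ t ∈ Finset.Ico k T,
    (estError N γu γθ t ω ⬝ᵥ S.errorWeight T t *ᵥ estError N γu γθ t ω
      + S.price (selection N γu γθ t ω))) ∂μ

/-- `C_k`: the optimal value of `selCost` over the selection policies from time `k` on. -/
noncomputable def selValue (N : Noise S μ) (T k : ℕ) (γu : CtrlPolicy S) (γθ : SelPolicy S) :
    ℝ≥0∞ :=
  sInf {v | ∃ γθ', SelPolicy.AgreeBefore k γθ γθ' ∧ v = selCost N T k γu γθ'}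

/-- The control at time `k` is certainty-equivalent: `U_k = -L_k E[X_k | I^c_k]` almost
surely. -/
def IsCertaintyEquivalent (N : Noise S μ) (T k : ℕ) (γu : CtrlPolicy S) (γθ : SelPolicy S) :
    Prop :=
  input N γu γθ k =ᵐ[μ] fun ω => -(S.gain T k *ᵥ estimate N γu γθ k ω)

end ClosedLoop

/-- `r_k = ∑_{t=k}^{T-1} tr(P_{t+1} 𝒲)`. -/
noncomputable def residual {n m p M : ℕ} (S : System n m p M) (T k : ℕ) : ℝ :=
  ∑ t ∈ Finset.Ico k T, (S.riccati T (t + 1) * S.covW).trace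

end QFLQG

/-!
The proof separates estimation from control. Write `X_t = X̄_t + Φ_t(U_0, …, U_{t-1})`, where `X̄` is
the state under zero control (`freeState`) and `Φ_t` is linear (`forcedState`).

*The control has no dual effect.* By induction on time, each control `U_t` is a function of the
uncontrolled outputs `Ȳ_s = C X̄_s + ν_s`, `s ≤ t`, so that `Y_0, …, Y_{t-1}, U_0, …, U_{t-1}` and
`Ȳ_0, …, Ȳ_{t-1}` generate the same σ-algebra (`loopHistory_eq`). The control therefore cancels in
the innovation, which is almost surely that of the uncontrolled system (`innovation_ae_eq`). For a
given selection policy, arrivals and selections then do not depend on the control policy either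
(`ae_arrival_selection_eq`); nor does the estimation error, since the past controls are functions of
the arrivals (`comap_ctrlInfo`, `estError_ae_eq_estError`).

*Completion of the square.* The expected cost of step `k` and `E[X_{k+1}ᵀ P_{k+1} X_{k+1}]` add up
to `E[X_kᵀ P_k X_k]` plus the cost of the estimation error and of the quantizer, plus
`tr(P_{k+1} 𝒲)`, plus the nonnegative `gap` `E[v_kᵀ (R + Bᵀ P_{k+1} B) v_k]`, where
`v_k = U_k + L_k E[X_k | I^c_k]` (`lintegral_oneStep`). The cross terms vanish since `W_k` is
independent of the past and the estimation error is orthogonal to `v_k`. Summation gives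
`costFrom_eq`, in which only the gaps depend on the controls from time `k` on; a gap vanishes
exactly for certainty-equivalent control (`gap_eq_zero_iff`), and such a control can be realized
after any past (`exists_certaintyEquivalent`).

*Finiteness.* Arrivals take finitely many values. Hence every control is a bounded random variable,
whatever the policy, so that all costs are finite; and there are only finitely many selection
policies up to time `T`, so that an optimal one exists (`isLeast_selValue`). Of the noises only the
first two moments and the independence matter.
-/

namespace QFLQG

/-! ### The Riccati recursion -/

namespace Plant

variable {n m : ℕ}

theorem weight_posDef (S : Plant n m) {P : Matrix (Fin n) (Fin n) ℝ} (hP : P.PosSemidef) :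
    (S.weight P).PosDef := by
  have h : (S.Bᵀ * P * S.B).PosSemidef := by
    simpa [conjTranspose_eq_transpose_of_trivial] using hP.conjTranspose_mul_mul_same S.B
  exact S.posDef_R.add_posSemidef h

theorem weight_mul_gainOf (S : Plant n m) {P : Matrix (Fin n) (Fin n) ℝ} (hP : P.PosSemidef) :
    S.weight P * S.gainOf P = S.Bᵀ * P * S.A := by
  have h : IsUnit (S.weight P).det := (S.weight_posDef hP).det_pos.ne'.isUnit
  rw [gainOf, Matrix.mul_assoc, Matrix.mul_assoc, Matrix.mul_nonsing_inv_cancel_left _ _ h,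
    Matrix.mul_assoc]

end Plant

theorem dotProduct_mulVec_comm {k : ℕ} {P : Matrix (Fin k) (Fin k) ℝ} (hP : Pᵀ = P)
    (x y : Fin k → ℝ) : x ⬝ᵥ P *ᵥ y = y ⬝ᵥ P *ᵥ x := by
  rw [dotProduct_mulVec, ← mulVec_transpose, hP, dotProduct_comm]

theorem transpose_eq_of_posSemidef {k : ℕ} {P : Matrix (Fin k) (Fin k) ℝ} (hP : P.PosSemidef) :
    Pᵀ = P := by
  simpa [IsHermitian, conjTranspose_eq_transpose_of_trivial] using hP.isHermitian

theorem quadForm_nonneg {k : ℕ} {P : Matrix (Fin k) (Fin k) ℝ} (hP : P.PosSemidef)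
    (x : Fin k → ℝ) : 0 ≤ x ⬝ᵥ P *ᵥ x := by
  simpa using hP.dotProduct_mulVec_nonneg x

namespace Plant

variable {n m : ℕ}

/-- Completion of the square in the control: the step that produces the Riccati recursion. -/
theorem completeSquare (S : Plant n m) {P : Matrix (Fin n) (Fin n) ℝ} (hP : P.PosSemidef)
    (x : Fin n → ℝ) (u : Fin m → ℝ) :
    x ⬝ᵥ S.Q₁ *ᵥ x + u ⬝ᵥ S.R *ᵥ u
        + (S.A *ᵥ x + S.B *ᵥ u) ⬝ᵥ P *ᵥ (S.A *ᵥ x + S.B *ᵥ u)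
      = x ⬝ᵥ (S.Q₁ + S.Aᵀ * P * S.A - (S.gainOf P)ᵀ * S.weight P * S.gainOf P) *ᵥ x
        + (u + S.gainOf P *ᵥ x) ⬝ᵥ S.weight P *ᵥ (u + S.gainOf P *ᵥ x) := by
  have hG := transpose_eq_of_posSemidef (S.weight_posDef hP).posSemidef
  have h1 : u ⬝ᵥ S.weight P *ᵥ (S.gainOf P *ᵥ x) = (S.B *ᵥ u) ⬝ᵥ P *ᵥ (S.A *ᵥ x) := by
    rw [mulVec_mulVec, weight_mul_gainOf S hP, Matrix.mul_assoc, ← mulVec_mulVec,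
      dotProduct_mulVec, vecMul_transpose, mulVec_mulVec]
  have h2 : u ⬝ᵥ S.weight P *ᵥ u = u ⬝ᵥ S.R *ᵥ u + (S.B *ᵥ u) ⬝ᵥ P *ᵥ (S.B *ᵥ u) := by
    rw [weight, add_mulVec, dotProduct_add, Matrix.mul_assoc, ← mulVec_mulVec,
      dotProduct_mulVec u S.Bᵀ, vecMul_transpose, mulVec_mulVec]
  have h3 : x ⬝ᵥ (S.Aᵀ * P * S.A) *ᵥ x = (S.A *ᵥ x) ⬝ᵥ P *ᵥ (S.A *ᵥ x) := by
    rw [Matrix.mul_assoc, ← mulVec_mulVec, dotProduct_mulVec x S.Aᵀ, vecMul_transpose,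
      mulVec_mulVec]
  have h4 : x ⬝ᵥ ((S.gainOf P)ᵀ * S.weight P * S.gainOf P) *ᵥ x
      = (S.gainOf P *ᵥ x) ⬝ᵥ S.weight P *ᵥ (S.gainOf P *ᵥ x) := by
    rw [Matrix.mul_assoc, ← mulVec_mulVec, dotProduct_mulVec x (S.gainOf P)ᵀ, vecMul_transpose,
      mulVec_mulVec]
  simp only [mulVec_add, add_dotProduct, dotProduct_add, sub_mulVec, add_mulVec, dotProduct_sub]
  rw [h3, h4, h2, h1, dotProduct_mulVec_comm hG (S.gainOf P *ᵥ x) u, h1,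
    dotProduct_mulVec_comm (transpose_eq_of_posSemidef hP) (S.A *ᵥ x) (S.B *ᵥ u)]
  ring

theorem riccatiAux_posSemidef (S : Plant n m) (j : ℕ) : (S.riccatiAux j).PosSemidef := by
  induction j with
  | zero => exact S.posSemidef_Q₂
  | succ j ih =>
    refine PosSemidef.of_dotProduct_mulVec_nonneg ?_ fun x => ?_
    · have h1 := transpose_eq_of_posSemidef ih
      have h2 := transpose_eq_of_posSemidef (S.weight_posDef ih).posSemidef
      have h3 := transpose_eq_of_posSemidef S.posSemidef_Q₁
      simp only [riccatiAux, IsHermitian, conjTranspose_eq_transpose_of_trivial, transpose_sub,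
        transpose_add, transpose_mul, transpose_transpose, h1, h2, h3, Matrix.mul_assoc]
    -- The control `-L x` makes the completed square vanish.
    · have h := S.completeSquare ih x (-(S.gainOf (S.riccatiAux j) *ᵥ x))
      rw [neg_add_cancel, zero_dotProduct, add_zero] at h
      simp only [star_trivial, riccatiAux]
      rw [← h]
      have := quadForm_nonneg S.posSemidef_Q₁ x
      have := quadForm_nonneg S.posDef_R.posSemidef (-(S.gainOf (S.riccatiAux j) *ᵥ x))
      have := quadForm_nonneg ih
        (S.A *ᵥ x + S.B *ᵥ (-(S.gainOf (S.riccatiAux j) *ᵥ x)))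
      positivity

theorem riccati_posSemidef (S : Plant n m) (T k : ℕ) : (S.riccati T k).PosSemidef :=
  S.riccatiAux_posSemidef _

/-- The weight `R + Bᵀ P_{k+1} B` of the control at time `k`. -/
noncomputable abbrev ctrlWeight (S : Plant n m) (T k : ℕ) : Matrix (Fin m) (Fin m) ℝ :=
  S.weight (S.riccati T (k + 1))

theorem ctrlWeight_posDef (S : Plant n m) (T k : ℕ) : (S.ctrlWeight T k).PosDef :=
  S.weight_posDef (S.riccati_posSemidef T (k + 1))

theorem quadForm_errorWeight (S : Plant n m) (T k : ℕ) (x : Fin n → ℝ) :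
    x ⬝ᵥ S.errorWeight T k *ᵥ x
      = (S.gain T k *ᵥ x) ⬝ᵥ S.ctrlWeight T k *ᵥ (S.gain T k *ᵥ x) := by
  rw [errorWeight, Matrix.mul_assoc, ← mulVec_mulVec, dotProduct_mulVec x (S.gain T k)ᵀ,
    vecMul_transpose, mulVec_mulVec]

theorem quadForm_errorWeight_nonneg (S : Plant n m) (T k : ℕ) (x : Fin n → ℝ) :
    0 ≤ x ⬝ᵥ S.errorWeight T k *ᵥ x := by
  rw [quadForm_errorWeight]
  exact quadForm_nonneg (S.ctrlWeight_posDef T k).posSemidef _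

theorem completeSquare_riccati (S : Plant n m) {T k : ℕ} (hk : k < T) (x : Fin n → ℝ)
    (u : Fin m → ℝ) :
    x ⬝ᵥ S.Q₁ *ᵥ x + u ⬝ᵥ S.R *ᵥ u
        + (S.A *ᵥ x + S.B *ᵥ u) ⬝ᵥ S.riccati T (k + 1) *ᵥ (S.A *ᵥ x + S.B *ᵥ u)
      = x ⬝ᵥ S.riccati T k *ᵥ x
        + (u + S.gain T k *ᵥ x) ⬝ᵥ S.ctrlWeight T k *ᵥ (u + S.gain T k *ᵥ x) := by
  rw [S.completeSquare (S.riccati_posSemidef T (k + 1)), S.riccati_step hk]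
  rfl

end Plant

/-! ### Conditional expectations and second moments -/

section Probability

variable {Ω : Type*} [mΩ : MeasurableSpace Ω] {μ : Measure Ω}

theorem condExp_comap_of_ae_eq [IsFiniteMeasure μ] {β E : Type*} [MeasurableSpace β]
    [NormedAddCommGroup E] [NormedSpace ℝ E] [CompleteSpace E] {X : Ω → E} (hX : Integrable X μ)
    {f g : Ω → β} (hf : Measurable f) (hg : Measurable g) (hfg : f =ᵐ[μ] g) {h : β → E}
    (hh : StronglyMeasurable h)
    (hXf : μ[X | MeasurableSpace.comap f inferInstance] =ᵐ[μ] h ∘ f) :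
    μ[X | MeasurableSpace.comap g inferInstance] =ᵐ[μ] h ∘ g := by
  have hfg' : h ∘ f =ᵐ[μ] h ∘ g := hfg.fun_comp h
  have hint : Integrable (h ∘ g) μ := (integrable_condExp.congr hXf).congr hfg'
  refine (ae_eq_condExp_of_forall_setIntegral_eq hg.comap_le hX (fun s _ _ => hint.integrableOn)
    ?_ ?_).symm
  · rintro _ ⟨B, hB, rfl⟩ -
    have hs : g ⁻¹' B =ᵐ[μ] f ⁻¹' B := by
      filter_upwards [hfg] with ω hω
      exact congrArg B hω.symm
    rw [setIntegral_congr_set hs, setIntegral_congr_set hs,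
      ← setIntegral_condExp hf.comap_le hX ⟨B, hB, rfl⟩]
    exact integral_congr_ae (ae_restrict_of_ae (hXf.trans hfg').symm)
  · exact (hh.comp_measurable (comap_measurable g)).aestronglyMeasurable

/-- Conditional expectations given two a.e. equal random variables coincide. -/
theorem condExp_comap_congr [IsFiniteMeasure μ] {β E : Type*} [MeasurableSpace β]
    [NormedAddCommGroup E] [NormedSpace ℝ E] [CompleteSpace E] {X : Ω → E} (hX : Integrable X μ)
    {f g : Ω → β} (hf : Measurable f) (hg : Measurable g) (hfg : f =ᵐ[μ] g) :
    μ[X | MeasurableSpace.comap f inferInstance]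
      =ᵐ[μ] μ[X | MeasurableSpace.comap g inferInstance] := by
  obtain ⟨h, hh, hXf⟩ := (stronglyMeasurable_condExp (μ := μ) (f := X)
    (m := MeasurableSpace.comap f inferInstance)).exists_eq_measurable_comp
  refine (Filter.EventuallyEq.of_eq hXf).trans ((hfg.fun_comp h).trans ?_)
  exact (condExp_comap_of_ae_eq hX hf hg hfg hh (.of_eq hXf)).symm

theorem memLp_apply {k : ℕ} {p : ℝ≥0∞} {f : Ω → Fin k → ℝ} (hf : MemLp f p μ) (i : Fin k) :
    MemLp (fun ω => f ω i) p μ :=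
  (ContinuousLinearMap.proj (R := ℝ) (φ := fun _ : Fin k => ℝ) i).comp_memLp' hf

theorem memLp_mulVec {k l : ℕ} {p : ℝ≥0∞} {f : Ω → Fin k → ℝ} (hf : MemLp f p μ)
    (P : Matrix (Fin l) (Fin k) ℝ) : MemLp (fun ω => P *ᵥ f ω) p μ :=
  (LinearMap.toContinuousLinearMap P.mulVecLin).comp_memLp' hf

theorem integrable_dotProduct {k : ℕ} {f g : Ω → Fin k → ℝ} (hf : MemLp f 2 μ)
    (hg : MemLp g 2 μ) : Integrable (fun ω => f ω ⬝ᵥ g ω) μ :=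
  integrable_finsetSum _ fun i _ => (memLp_apply hf i).integrable_mul (memLp_apply hg i)

/-- The residual `X - E[X | 𝓖]` is orthogonal to the square-integrable `𝓖`-measurable vectors. -/
theorem integral_dotProduct_sub_condExp {Ω : Type*} {𝓖 mΩ : MeasurableSpace Ω} {μ : Measure Ω}
    [IsFiniteMeasure μ] {k : ℕ} (h𝓖 : 𝓖 ≤ mΩ) {X v : Ω → Fin k → ℝ} (hX : MemLp X 2 μ)
    (hv : StronglyMeasurable[𝓖] v) (hv2 : MemLp v 2 μ) :
    ∫ ω, v ω ⬝ᵥ (X ω - (μ[X | 𝓖]) ω) ∂μ = 0 := by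
  have hE : MemLp (μ[X | 𝓖]) 2 μ := hX.condExp one_le_two
  have hint (i : Fin k) : Integrable (fun ω => v ω i * (X ω i - (μ[X | 𝓖]) ω i)) μ :=
    (memLp_apply hv2 i).integrable_mul ((memLp_apply hX i).sub (memLp_apply hE i))
  simp only [dotProduct, Pi.sub_apply]
  rw [integral_finsetSum _ fun i _ => hint i]
  refine Finset.sum_eq_zero fun i _ => ?_
  have h1 : Integrable ((fun ω => v ω i) * fun ω => X ω i) μ :=
    (memLp_apply hv2 i).integrable_mul (memLp_apply hX i)
  have h2 : Integrable (fun ω => v ω i * (μ[X | 𝓖]) ω i) μ :=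
    (memLp_apply hv2 i).integrable_mul (memLp_apply hE i)
  have hvi : StronglyMeasurable[𝓖] fun ω => v ω i :=
    (continuous_apply i).comp_stronglyMeasurable hv
  have hcoord : (fun ω => (μ[X | 𝓖]) ω i) =ᵐ[μ] μ[fun ω => X ω i | 𝓖] :=
    (ContinuousLinearMap.proj (R := ℝ) (φ := fun _ : Fin k => ℝ) i).comp_condExp_comm
      (hX.integrable one_le_two)
  have hpull := condExp_mul_of_stronglyMeasurable_left hvi h1
    ((memLp_apply hX i).integrable one_le_two)
  have h3 : ∫ ω, v ω i * X ω i ∂μ = ∫ ω, v ω i * (μ[X | 𝓖]) ω i ∂μ := by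
    rw [show (∫ ω, v ω i * X ω i ∂μ) = ∫ ω, ((fun ω => v ω i) * fun ω => X ω i) ω ∂μ from rfl,
      ← integral_condExp h𝓖]
    refine integral_congr_ae ?_
    filter_upwards [hpull, hcoord] with ω h h'
    rw [h, h', Pi.mul_apply]
  simp only [mul_sub]
  exact (integral_sub h1 h2).trans (sub_eq_zero.2 h3)

theorem integral_dotProduct_eq_zero_of_indep {Ω : Type*} {𝓖 mΩ : MeasurableSpace Ω}
    {μ : Measure Ω} {k : ℕ} {W v : Ω → Fin k → ℝ} (hW : Measurable W) (hW0 : ∀ i, ∫ ω, W ω i ∂μ = 0)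
    (hind : Indep (MeasurableSpace.comap W inferInstance) 𝓖 μ) (hv : Measurable[𝓖] v)
    (hWv : ∀ i, Integrable (fun ω => W ω i * v ω i) μ) (hv' : Measurable v) :
    ∫ ω, W ω ⬝ᵥ v ω ∂μ = 0 := by
  simp only [dotProduct]
  rw [integral_finsetSum _ fun i _ => hWv i]
  refine Finset.sum_eq_zero fun i _ => ?_
  have hWi : Measurable[MeasurableSpace.comap W inferInstance] fun ω => W ω i :=
    (measurable_pi_apply i).comp (comap_measurable W)
  have hvi : Measurable[𝓖] fun ω => v ω i := (measurable_pi_apply i).comp hv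
  have h : IndepFun (fun ω => W ω i) (fun ω => v ω i) μ :=
    (IndepFun_iff_Indep _ _ _).2 (indep_of_indep_of_le_left
      (indep_of_indep_of_le_right hind hvi.comap_le) hWi.comap_le)
  rw [h.integral_fun_mul_eq_mul_integral
    ((measurable_pi_apply i).comp hW).aestronglyMeasurable
    ((measurable_pi_apply i).comp hv').aestronglyMeasurable, hW0, zero_mul]

theorem integral_quadForm {k : ℕ} {W : Ω → Fin k → ℝ} (hW : MemLp W 2 μ)
    (P K : Matrix (Fin k) (Fin k) ℝ) (hK : ∀ i j, ∫ ω, W ω i * W ω j ∂μ = K i j) :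
    ∫ ω, W ω ⬝ᵥ P *ᵥ W ω ∂μ = (P * K).trace := by
  have hint (i j : Fin k) : Integrable (fun ω => W ω i * (P i j * W ω j)) μ :=
    (memLp_apply hW i).integrable_mul ((memLp_apply hW j).const_mul (P i j))
  simp only [dotProduct, mulVec, Finset.mul_sum]
  rw [integral_finsetSum _ fun i _ => integrable_finsetSum _ fun j _ => hint i j]
  simp only [Matrix.trace, Matrix.diag, Matrix.mul_apply]
  refine Finset.sum_congr rfl fun i _ => ?_
  rw [integral_finsetSum _ fun j _ => hint i j]
  refine Finset.sum_congr rfl fun j _ => ?_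
  rw [← hK j i, ← integral_const_mul]
  exact integral_congr_ae (.of_forall fun ω => by ring)

theorem memLp_of_hasLaw_gaussian {k : ℕ} {X : Ω → Fin k → ℝ} {c : EuclideanSpace ℝ (Fin k)}
    {K : Matrix (Fin k) (Fin k) ℝ}
    (hX : HasLaw (fun ω => WithLp.toLp 2 (X ω)) (multivariateGaussian c K) μ) : MemLp X 2 μ := by
  have h : MemLp (id ∘ fun ω => WithLp.toLp 2 (X ω)) 2 μ := by
    refine MemLp.comp_of_map ?_ hX.aemeasurable
    rw [hX.map_eq]
    exact IsGaussian.memLp_two_id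
  exact (PiLp.continuousLinearEquiv 2 ℝ fun _ : Fin k => ℝ).toContinuousLinearMap.comp_memLp' h

theorem integral_eq_of_hasLaw_gaussian {k : ℕ} {X : Ω → Fin k → ℝ} {c : EuclideanSpace ℝ (Fin k)}
    {K : Matrix (Fin k) (Fin k) ℝ}
    (hX : HasLaw (fun ω => WithLp.toLp 2 (X ω)) (multivariateGaussian c K) μ) (i : Fin k) :
    ∫ ω, X ω i ∂μ = c i := by
  have h := hX.integral_comp (f := fun x : EuclideanSpace ℝ (Fin k) => x i)
    (by fun_prop)
  have h2 := (EuclideanSpace.proj (𝕜 := ℝ) i).integral_comp_id_comm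
    (IsGaussian.integrable_id (μ := multivariateGaussian c K))
  rw [integral_id_multivariateGaussian] at h2
  exact h.trans h2

theorem integral_mul_of_hasLaw_gaussian {k : ℕ} {X : Ω → Fin k → ℝ}
    {K : Matrix (Fin k) (Fin k) ℝ} (hK : K.PosSemidef)
    (hX : HasLaw (fun ω => WithLp.toLp 2 (X ω)) (multivariateGaussian 0 K) μ) (i j : Fin k) :
    ∫ ω, X ω i * X ω j ∂μ = K i j := by
  have h := hX.covariance_fun_comp (f := fun x : EuclideanSpace ℝ (Fin k) => x i)
    (g := fun x : EuclideanSpace ℝ (Fin k) => x j) (by fun_prop) (by fun_prop)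
  rw [covariance_eval_multivariateGaussian hK, covariance] at h
  simpa [integral_eq_of_hasLaw_gaussian hX] using h

end Probability

/-! ### The part of the closed loop that no policy can influence -/

section FreeSystem

variable {n m p M : ℕ} {S : System n m p M} {Ω : Type*} [mΩ : MeasurableSpace Ω] {μ : Measure Ω}

/-- The state that would result from zero control. -/
noncomputable def freeState (N : Noise S μ) : ℕ → Ω → Fin n → ℝ
  | 0 => N.X₀
  | t + 1 => fun ω => S.A *ᵥ freeState N t ω + N.W t ω

/-- The output that would result from zero control. -/
noncomputable def freeOutput (N : Noise S μ) (t : ℕ) (ω : Ω) : Fin p → ℝ :=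
  S.C *ᵥ freeState N t ω + N.V t ω

/-- The contribution of the controls `u_0, …, u_{t-1}` to the state at time `t`. -/
noncomputable def forcedState (S : System n m p M) : (t : ℕ) → (Fin t → Fin m → ℝ) → Fin n → ℝ
  | 0, _ => 0
  | t + 1, u => S.A *ᵥ forcedState S t (fun s => u s.castSucc) + S.B *ᵥ u (Fin.last t)

theorem measurable_tuple {α : Type*} {mα : MeasurableSpace α} {t : ℕ} {β : Type*}
    [MeasurableSpace β] {f : α → Fin t → β} (hf : ∀ s, Measurable fun a => f a s) : Measurable f :=
  measurable_pi_lambda f hf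

theorem finite_range_pi {α : Type*} {t : ℕ} {β : Fin t → Type*} {f : (s : Fin t) → α → β s}
    (hf : ∀ s, (Set.range (f s)).Finite) : (Set.range fun ω => fun s => f s ω).Finite :=
  (Set.Finite.pi hf).subset (by rintro _ ⟨ω, rfl⟩ s -; exact ⟨ω, rfl⟩)

theorem measurable_mulVec {k l : ℕ} (P : Matrix (Fin l) (Fin k) ℝ) :
    Measurable fun x : Fin k → ℝ => P *ᵥ x :=
  (LinearMap.toContinuousLinearMap P.mulVecLin).continuous.measurable

theorem measurable_forcedState (t : ℕ) : Measurable (forcedState S t) := by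
  induction t with
  | zero => exact measurable_const
  | succ t ih =>
    exact ((measurable_mulVec S.A).comp (ih.comp (measurable_tuple fun s =>
      measurable_pi_apply _))).add ((measurable_mulVec S.B).comp (measurable_pi_apply _))

theorem measurable_freeState (N : Noise S μ) (t : ℕ) : Measurable (freeState N t) := by
  induction t with
  | zero => exact N.measurable_X₀
  | succ t ih => exact ((measurable_mulVec S.A).comp ih).add (N.measurable_W t)

theorem measurable_freeOutput (N : Noise S μ) (t : ℕ) : Measurable (freeOutput N t) :=
  ((measurable_mulVec S.C).comp (measurable_freeState N t)).add (N.measurable_V t)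

theorem memLp_freeState (N : Noise S μ) (t : ℕ) : MemLp (freeState N t) 2 μ := by
  induction t with
  | zero => exact memLp_of_hasLaw_gaussian N.law_X₀
  | succ t ih => exact (memLp_mulVec ih S.A).add (memLp_of_hasLaw_gaussian (N.law_W t))

theorem memLp_freeOutput (N : Noise S μ) (t : ℕ) : MemLp (freeOutput N t) 2 μ :=
  (memLp_mulVec (memLp_freeState N t) S.C).add (memLp_of_hasLaw_gaussian (N.law_V t))

/-- The σ-algebra generated by the uncontrolled outputs before time `t`. -/
noncomputable abbrev freeHistory (N : Noise S μ) (t : ℕ) : MeasurableSpace Ω :=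
  MeasurableSpace.comap (fun ω => fun s : Fin t => freeOutput N s ω) inferInstance

theorem freeHistory_le (N : Noise S μ) (t : ℕ) : freeHistory N t ≤ mΩ :=
  (measurable_tuple fun s : Fin t => measurable_freeOutput N s).comap_le

theorem measurable_freeOutput_freeHistory (N : Noise S μ) {s t : ℕ} (h : s < t) :
    Measurable[freeHistory N t] (freeOutput N s) :=
  (measurable_pi_apply (⟨s, h⟩ : Fin t)).comp
    (comap_measurable fun ω => fun s : Fin t => freeOutput N s ω)

theorem freeHistory_mono (N : Noise S μ) : Monotone (freeHistory N) := fun _ _ hst =>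
  (measurable_tuple fun r => measurable_freeOutput_freeHistory N
    (r.2.trans_le hst)).comap_le

/-- The innovation of the uncontrolled system. -/
noncomputable def freeInnovation (N : Noise S μ) (t : ℕ) (ω : Ω) : Fin p → ℝ :=
  freeOutput N t ω - (μ[freeOutput N t | freeHistory N t]) ω

end FreeSystem

/-! ### The closed loop without dual effect of the control -/

section ClosedLoop

variable {n m p M : ℕ} {S : System n m p M} {Ω : Type*} [mΩ : MeasurableSpace Ω] {μ : Measure Ω}
  (N : Noise S μ) (γu : CtrlPolicy S) (γθ : SelPolicy S)

instance : Finite (Obs S) := inferInstanceAs (Finite ((i : Fin M) → Option (S.quantizer i).range))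

instance : DiscreteMeasurableSpace (Obs S) := ⟨fun _ => trivial⟩

theorem state_succ (t : ℕ) (ω : Ω) : state N γu γθ (t + 1) ω
    = S.A *ᵥ state N γu γθ t ω + S.B *ᵥ input N γu γθ t ω + N.W t ω := by
  rw [state]

theorem state_eq (t : ℕ) (ω : Ω) : state N γu γθ t ω
    = freeState N t ω + forcedState S t fun s => input N γu γθ s ω := by
  induction t with
  | zero => simp [state, freeState, forcedState]
  | succ t ih =>
    rw [state_succ, ih, freeState, forcedState, mulVec_add]
    simp only [Fin.val_castSucc, Fin.val_last]
    abel

theorem output_eq (t : ℕ) (ω : Ω) : output N γu γθ t ω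
    = freeOutput N t ω + S.C *ᵥ forcedState S t fun s => input N γu γθ s ω := by
  rw [output, state_eq, mulVec_add, freeOutput]
  abel

/-- The σ-algebra generated by the outputs and the controls before time `t`. -/
noncomputable abbrev loopHistory (t : ℕ) : MeasurableSpace Ω :=
  MeasurableSpace.comap
    (fun ω => fun s : Fin t => (output N γu γθ s ω, input N γu γθ s ω)) inferInstance

theorem innovation_eq (t : ℕ) (ω : Ω) : innovation N γu γθ t ω
    = output N γu γθ t ω - (μ[output N γu γθ t | loopHistory N γu γθ t]) ω := by
  rw [innovation]

theorem input_eq (t : ℕ) (ω : Ω) :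
    input N γu γθ t ω = γu.act t (ctrlInfo N γu γθ t ω) := by
  rw [input]
  rfl

theorem selection_eq (t : ℕ) (ω : Ω) : selection N γu γθ t ω = γθ.act t
    (fun s : Fin t => arrival N γu γθ s ω, fun s : Fin t => selection N γu γθ s ω) := by
  rw [selection]

/-- What arrives at time `t` when the quantizers `sel` have been applied to the innovations
`inn`. -/
noncomputable def arrivalOf (S : System n m p M) (t : ℕ) (sel : ℕ → Fin M)
    (inn : ℕ → Fin p → ℝ) : Obs S := fun i =>
  if S.delay i ≤ t ∧ sel (t - S.delay i) = i then
    some ((S.quantizer i).quantize (inn (t - S.delay i)))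
  else none

theorem arrival_eq (t : ℕ) (ω : Ω) : arrival N γu γθ t ω
    = arrivalOf S t (fun s => selection N γu γθ s ω) (fun s => innovation N γu γθ s ω) := by
  funext i
  rw [arrival]
  rfl

theorem arrivalOf_congr {t : ℕ} {sel sel' : ℕ → Fin M} {inn inn' : ℕ → Fin p → ℝ}
    (hsel : ∀ s ≤ t, sel s = sel' s) (hinn : ∀ s ≤ t, inn s = inn' s) :
    arrivalOf S t sel inn = arrivalOf S t sel' inn' := by
  funext i
  rw [arrivalOf, arrivalOf, hsel _ (Nat.sub_le _ _), hinn _ (Nat.sub_le _ _)]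

theorem measurable_arrivalOf {α : Type*} {mα : MeasurableSpace α} {t : ℕ} {sel : ℕ → α → Fin M}
    {inn : ℕ → α → Fin p → ℝ} (hsel : ∀ s ≤ t, Measurable (sel s))
    (hinn : ∀ s ≤ t, Measurable (inn s)) :
    Measurable fun a => arrivalOf S t (fun s => sel s a) (fun s => inn s a) := by
  refine measurable_to_countable' fun o => ?_
  have h : (fun a => arrivalOf S t (fun s => sel s a) (fun s => inn s a)) ⁻¹' {o}
      = ⋂ i, {a | arrivalOf S t (fun s => sel s a) (fun s => inn s a) i = o i} := by
    ext a
    rw [Set.mem_iInter]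
    exact funext_iff
  rw [h]
  refine MeasurableSet.iInter fun i => ?_
  have h1 : MeasurableSet {a | sel (t - S.delay i) a = i} :=
    hsel _ (Nat.sub_le _ _) (MeasurableSet.singleton i)
  have h2 : Measurable fun a => (S.quantizer i).quantize (inn (t - S.delay i) a) :=
    (S.quantizer i).measurable_quantize.comp (hinn _ (Nat.sub_le _ _))
  simp only [arrivalOf]
  by_cases hd : S.delay i ≤ t
  · simp only [hd, true_and]
    rcases ho : o i with _ | v
    · convert h1.compl using 1
      ext a
      simp
    · convert h1.inter (h2 (MeasurableSet.singleton v)) using 1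
      ext a
      simp [ite_eq_iff]
  · simp [hd]

/-- The innovation, the selection, the arrival and the control at time `t` are determined by the
uncontrolled outputs up to time `t`. -/
theorem measurable_loop_freeHistory (t : ℕ) :
    Measurable[freeHistory N (t + 1)] (innovation N γu γθ t) ∧
    Measurable[freeHistory N (t + 1)] (selection N γu γθ t) ∧
    Measurable[freeHistory N (t + 1)] (arrival N γu γθ t) ∧
    Measurable[freeHistory N (t + 1)] (input N γu γθ t) := by
  induction t using Nat.strong_induction_on with
  | _ t ih =>
  have up {s : ℕ} (hs : s < t) : freeHistory N (s + 1) ≤ freeHistory N t := freeHistory_mono N hs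
  have up' : freeHistory N t ≤ freeHistory N (t + 1) := freeHistory_mono N t.le_succ
  have hin : Measurable[freeHistory N t] fun ω => fun s : Fin t => input N γu γθ s ω :=
    measurable_tuple fun s => (ih s s.2).2.2.2.mono (up s.2) le_rfl
  have hout {s : ℕ} (hs : s ≤ t) : Measurable[freeHistory N (s + 1)] (output N γu γθ s) := by
    have h : Measurable[freeHistory N (s + 1)] fun ω => fun r : Fin s => input N γu γθ r ω :=
      measurable_tuple fun r => (ih r (r.2.trans_le hs)).2.2.2.mono
        (freeHistory_mono N (by have := r.2; omega)) le_rfl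
    rw [funext (output_eq N γu γθ s)]
    exact (measurable_freeOutput_freeHistory N s.lt_succ_self).add
      ((measurable_mulVec S.C).comp ((measurable_forcedState s).comp h))
  have hhist : loopHistory N γu γθ t ≤ freeHistory N t :=
    Measurable.comap_le (measurable_tuple fun s =>
      ((hout s.2.le).mono (up s.2) le_rfl).prodMk ((ih s s.2).2.2.2.mono (up s.2) le_rfl))
  have hinn : Measurable[freeHistory N (t + 1)] (innovation N γu γθ t) := by
    rw [funext (innovation_eq N γu γθ t)]
    exact (hout le_rfl).sub (stronglyMeasurable_condExp.measurable.mono (hhist.trans up') le_rfl)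
  have hsel : Measurable[freeHistory N (t + 1)] (selection N γu γθ t) := by
    rw [funext (selection_eq N γu γθ t)]
    refine (γθ.measurable_act t).comp (Measurable.prodMk ?_ ?_)
    · exact measurable_tuple fun s =>
        (ih s s.2).2.2.1.mono ((up s.2).trans up') le_rfl
    · exact measurable_tuple fun s =>
        (ih s s.2).2.1.mono ((up s.2).trans up') le_rfl
  have le_cases {s : ℕ} (hs : s ≤ t) : s < t ∨ s = t := hs.lt_or_eq
  have harr : Measurable[freeHistory N (t + 1)] (arrival N γu γθ t) := by
    rw [funext (arrival_eq N γu γθ t)]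
    refine measurable_arrivalOf (fun s hs => ?_) fun s hs => ?_
    · rcases le_cases hs with h | rfl
      · exact (ih s h).2.1.mono ((up h).trans up') le_rfl
      · exact hsel
    · rcases le_cases hs with h | rfl
      · exact (ih s h).1.mono ((up h).trans up') le_rfl
      · exact hinn
  refine ⟨hinn, hsel, harr, ?_⟩
  rw [funext (input_eq N γu γθ t)]
  refine (γu.measurable_act t).comp (Measurable.prodMk ?_ (hin.mono up' le_rfl))
  refine measurable_tuple fun s => ?_
  rcases le_cases (Nat.lt_succ_iff.1 s.2) with h | h
  · exact (ih s h).2.2.1.mono ((up h).trans up') le_rfl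
  · change Measurable[freeHistory N (t + 1)] (arrival N γu γθ s)
    rwa [h]

theorem measurable_selection (t : ℕ) : Measurable (selection N γu γθ t) :=
  (measurable_loop_freeHistory N γu γθ t).2.1.mono (freeHistory_le N _) le_rfl

theorem measurable_arrival (t : ℕ) : Measurable (arrival N γu γθ t) :=
  (measurable_loop_freeHistory N γu γθ t).2.2.1.mono (freeHistory_le N _) le_rfl

theorem measurable_input_freeHistory {s t : ℕ} (h : s < t) :
    Measurable[freeHistory N t] (input N γu γθ s) :=
  (measurable_loop_freeHistory N γu γθ s).2.2.2.mono (freeHistory_mono N h) le_rfl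

theorem measurable_input (t : ℕ) : Measurable (input N γu γθ t) :=
  (measurable_input_freeHistory N γu γθ t.lt_succ_self).mono (freeHistory_le N _) le_rfl

theorem measurable_ctrlInfo (t : ℕ) : Measurable (ctrlInfo N γu γθ t) :=
  Measurable.prodMk (measurable_tuple fun s => measurable_arrival N γu γθ s)
    (measurable_tuple fun s => measurable_input N γu γθ s)

/-- The controls carry no information beyond the uncontrolled outputs. -/
theorem loopHistory_eq (t : ℕ) : loopHistory N γu γθ t = freeHistory N t := by
  apply le_antisymm
  · refine Measurable.comap_le (measurable_tuple fun s => Measurable.prodMk ?_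
      (measurable_input_freeHistory N γu γθ s.2))
    rw [funext (output_eq N γu γθ s)]
    exact (measurable_freeOutput_freeHistory N s.2).add ((measurable_mulVec S.C).comp
      ((measurable_forcedState s).comp (measurable_tuple fun r =>
        measurable_input_freeHistory N γu γθ (r.2.trans s.2))))
  · have hpair (s : Fin t) : Measurable[loopHistory N γu γθ t]
        fun ω => (output N γu γθ s ω, input N γu γθ s ω) :=
      (measurable_pi_apply s).comp (comap_measurable
        (fun ω => fun s : Fin t => (output N γu γθ s ω, input N γu γθ s ω)))
    refine Measurable.comap_le (measurable_tuple fun s => ?_)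
    have h : (fun ω => freeOutput N s ω) = fun ω => output N γu γθ s ω
        - S.C *ᵥ forcedState S s fun r => input N γu γθ r ω := by
      funext ω
      rw [output_eq, add_sub_cancel_right]
    rw [h]
    exact (measurable_fst.comp (hpair s)).sub ((measurable_mulVec S.C).comp
      ((measurable_forcedState s).comp (measurable_tuple fun r =>
        measurable_snd.comp (hpair ⟨r, r.2.trans s.2⟩))))

/-- Only finitely many values can be received, so a control takes only finitely many values. -/
theorem finite_range_input (t : ℕ) : (Set.range (input N γu γθ t)).Finite := by
  induction t using Nat.strong_induction_on with
  | _ t ih =>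
  have h := (finite_range_pi fun s : Fin t => ih s s.2)
  have h' := (Set.toFinite (Set.univ : Set (Fin (t + 1) → Obs S))).prod h
  refine (h'.image (γu.act t)).subset ?_
  rintro _ ⟨ω, rfl⟩
  exact ⟨ctrlInfo N γu γθ t ω, ⟨trivial, ω, rfl⟩, (input_eq N γu γθ t ω).symm⟩

theorem memLp_of_finite_range [IsFiniteMeasure μ] {k : ℕ} {q : ℝ≥0∞} {f : Ω → Fin k → ℝ}
    (hf : Measurable f) (hr : (Set.range f).Finite) : MemLp f q μ := by
  obtain ⟨c, hc⟩ := hr.isBounded.exists_norm_le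
  exact MemLp.of_bound hf.aestronglyMeasurable c (.of_forall fun ω => hc _ ⟨ω, rfl⟩)

theorem memLp_input [IsFiniteMeasure μ] (t : ℕ) (q : ℝ≥0∞) : MemLp (input N γu γθ t) q μ :=
  memLp_of_finite_range (measurable_input N γu γθ t) (finite_range_input N γu γθ t)

theorem memLp_forcedState [IsFiniteMeasure μ] (t : ℕ) (q : ℝ≥0∞) :
    MemLp (fun ω => forcedState S t fun s => input N γu γθ s ω) q μ := by
  refine memLp_of_finite_range ((measurable_forcedState t).comp (measurable_tuple fun s =>
    measurable_input N γu γθ s)) ?_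
  have h := finite_range_pi fun s : Fin t => finite_range_input N γu γθ s
  rw [← Set.image_univ] at h ⊢
  exact Set.image_image (forcedState S t) _ _ ▸ h.image _

theorem memLp_state [IsFiniteMeasure μ] (t : ℕ) : MemLp (state N γu γθ t) 2 μ := by
  rw [funext (state_eq N γu γθ t)]
  exact (memLp_freeState N t).add (memLp_forcedState N γu γθ t 2)

/-- The innovation is almost surely the one of the uncontrolled system. -/
theorem innovation_ae_eq [IsFiniteMeasure μ] (t : ℕ) :
    innovation N γu γθ t =ᵐ[μ] freeInnovation N t := by
  have hu : StronglyMeasurable[freeHistory N t]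
      fun ω => S.C *ᵥ forcedState S t fun s => input N γu γθ s ω :=
    ((measurable_mulVec S.C).comp ((measurable_forcedState t).comp (measurable_tuple fun s =>
        measurable_input_freeHistory N γu γθ s.2))).stronglyMeasurable
  have hu1 : Integrable (fun ω => S.C *ᵥ forcedState S t fun s => input N γu γθ s ω) μ :=
    (memLp_mulVec (memLp_forcedState N γu γθ t 2) S.C).integrable one_le_two
  have h := condExp_add ((memLp_freeOutput N t).integrable one_le_two) hu1 (freeHistory N t)
  rw [condExp_of_stronglyMeasurable (freeHistory_le N t) hu hu1] at h
  filter_upwards [h] with ω hω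
  rw [innovation_eq, loopHistory_eq, output_eq, freeInnovation,
    show output N γu γθ t = freeOutput N t
      + fun ω => S.C *ᵥ forcedState S t fun s => input N γu γθ s ω from
      funext (output_eq N γu γθ t), hω, Pi.add_apply]
  abel

/-- The control policy has no influence on the arrivals and on the selections. -/
theorem ae_arrival_selection_eq [IsFiniteMeasure μ] (γu' : CtrlPolicy S) :
    ∀ᵐ ω ∂μ, ∀ t, arrival N γu γθ t ω = arrival N γu' γθ t ω ∧
      selection N γu γθ t ω = selection N γu' γθ t ω := by
  have h : ∀ᵐ ω ∂μ, ∀ t, innovation N γu γθ t ω = innovation N γu' γθ t ω :=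
    ae_all_iff.2 fun t => (innovation_ae_eq N γu γθ t).trans (innovation_ae_eq N γu' γθ t).symm
  filter_upwards [h] with ω hω t
  induction t using Nat.strong_induction_on with
  | _ t ih =>
  have hsel : selection N γu γθ t ω = selection N γu' γθ t ω := by
    rw [selection_eq, selection_eq N γu']
    congr 2 <;> funext s
    · exact (ih s s.2).1
    · exact (ih s s.2).2
  refine ⟨?_, hsel⟩
  rw [arrival_eq, arrival_eq N γu']
  refine arrivalOf_congr (fun s hs => ?_) fun s _ => hω s
  rcases hs.lt_or_eq with h | rfl
  · exact (ih s h).2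
  · exact hsel

end ClosedLoop

/-! ### Causality -/

section Causality

variable {n m p M : ℕ} {S : System n m p M} {Ω : Type*} [mΩ : MeasurableSpace Ω] {μ : Measure Ω}
  (N : Noise S μ) {γu γu' : CtrlPolicy S} {γθ γθ' : SelPolicy S}

/-- Policies that agree before time `k` generate the same closed loop before time `k`. -/
theorem loop_congr {k : ℕ} (hu : γu.AgreeBefore k γu') (hθ : γθ.AgreeBefore k γθ') (t : ℕ)
    (ht : t < k) : selection N γu' γθ' t = selection N γu γθ t ∧
      arrival N γu' γθ' t = arrival N γu γθ t ∧ input N γu' γθ' t = input N γu γθ t := by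
  induction t using Nat.strong_induction_on with
  | _ t ih =>
  have hin (s : ℕ) (hs : s < t) : input N γu' γθ' s = input N γu γθ s :=
    (ih s hs (hs.trans ht)).2.2
  have hout (s : ℕ) (hs : s ≤ t) : output N γu' γθ' s = output N γu γθ s := by
    funext ω
    rw [output_eq, output_eq]
    congr 3
    funext r
    rw [hin r (r.2.trans_le hs)]
  have hinn (s : ℕ) (hs : s ≤ t) : innovation N γu' γθ' s = innovation N γu γθ s := by
    funext ω
    rw [innovation_eq, innovation_eq, hout s hs, loopHistory_eq, loopHistory_eq]
  have hsel : selection N γu' γθ' t = selection N γu γθ t := by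
    funext ω
    rw [selection_eq, selection_eq, hθ t ht]
    congr 2 <;> funext s
    · rw [(ih s s.2 (s.2.trans ht)).2.1]
    · rw [(ih s s.2 (s.2.trans ht)).1]
  have harr : arrival N γu' γθ' t = arrival N γu γθ t := by
    funext ω
    rw [arrival_eq, arrival_eq]
    refine arrivalOf_congr (fun s hs => ?_) fun s hs => by rw [hinn s hs]
    rcases hs.lt_or_eq with h | rfl
    · rw [(ih s h (h.trans ht)).1]
    · rw [hsel]
  refine ⟨hsel, harr, ?_⟩
  funext ω
  rw [input_eq, input_eq, hu t ht]
  refine congrArg _ (Prod.ext ?_ ?_) <;> funext s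
  · change arrival N γu' γθ' s ω = arrival N γu γθ s ω
    rcases (Nat.lt_succ_iff.1 s.2).lt_or_eq with h | h
    · rw [(ih s h (h.trans ht)).2.1]
    · rw [h, harr]
  · exact congrFun (hin s s.2) ω

theorem state_congr {k : ℕ} (hu : γu.AgreeBefore k γu') (hθ : γθ.AgreeBefore k γθ') {t : ℕ}
    (ht : t ≤ k) : state N γu' γθ' t = state N γu γθ t := by
  funext ω
  rw [state_eq, state_eq]
  congr 2
  funext s
  rw [(loop_congr N hu hθ s (s.2.trans_le ht)).2.2]

theorem ctrlInfo_congr {k : ℕ} (hu : γu.AgreeBefore k γu') (hθ : γθ.AgreeBefore k γθ') {t : ℕ}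
    (ht : t < k) : ctrlInfo N γu' γθ' t = ctrlInfo N γu γθ t := by
  funext ω
  refine Prod.ext ?_ ?_ <;> funext s
  · exact congrFun (loop_congr N hu hθ s (by have := s.2; omega)).2.1 ω
  · exact congrFun (loop_congr N hu hθ s (s.2.trans ht)).2.2 ω

theorem estimate_congr {k : ℕ} (hu : γu.AgreeBefore k γu') (hθ : γθ.AgreeBefore k γθ') {t : ℕ}
    (ht : t < k) : estimate N γu' γθ' t = estimate N γu γθ t := by
  rw [estimate, estimate, state_congr N hu hθ ht.le, ctrlInfo_congr N hu hθ ht]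

theorem estError_congr {k : ℕ} (hu : γu.AgreeBefore k γu') (hθ : γθ.AgreeBefore k γθ') {t : ℕ}
    (ht : t < k) : estError N γu' γθ' t = estError N γu γθ t := by
  rw [estError, estError, state_congr N hu hθ ht.le, estimate_congr N hu hθ ht]

theorem stageCost_congr {k : ℕ} (hu : γu.AgreeBefore k γu') (hθ : γθ.AgreeBefore k γθ') {t : ℕ}
    (ht : t < k) : stageCost N γu' γθ' t = stageCost N γu γθ t := by
  funext ω
  rw [stageCost, stageCost, state_congr N hu hθ ht.le, (loop_congr N hu hθ t ht).2.2,
    (loop_congr N hu hθ t ht).1]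

end Causality

/-! ### The controller's estimate -/

section Estimate

variable {n m p M : ℕ} {S : System n m p M} {Ω : Type*} [mΩ : MeasurableSpace Ω] {μ : Measure Ω}
  (N : Noise S μ) (γu : CtrlPolicy S) (γθ : SelPolicy S)

/-- Everything that has arrived up to time `t`. -/
noncomputable def arrivals (t : ℕ) (ω : Ω) : Fin (t + 1) → Obs S :=
  fun s => arrival N γu γθ s ω

theorem measurable_arrivals (t : ℕ) : Measurable (arrivals N γu γθ t) :=
  measurable_tuple fun s => measurable_arrival N γu γθ s

theorem measurable_arrival_comap {s t : ℕ} (h : s ≤ t) :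
    Measurable[MeasurableSpace.comap (arrivals N γu γθ t) inferInstance] (arrival N γu γθ s) :=
  (measurable_pi_apply (⟨s, Nat.lt_succ_iff.2 h⟩ : Fin (t + 1))).comp
    (comap_measurable (arrivals N γu γθ t))

theorem measurable_input_comap {s t : ℕ} (h : s ≤ t) :
    Measurable[MeasurableSpace.comap (arrivals N γu γθ t) inferInstance] (input N γu γθ s) := by
  induction s using Nat.strong_induction_on with
  | _ s ih =>
  rw [funext (input_eq N γu γθ s)]
  refine (γu.measurable_act s).comp (Measurable.prodMk ?_ ?_)
  · exact measurable_tuple fun r => measurable_arrival_comap N γu γθ (by have := r.2; omega)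
  · exact measurable_tuple fun r => ih r r.2 (r.2.le.trans h)

/-- The past controls are redundant in the controller's information. -/
theorem comap_ctrlInfo (t : ℕ) : MeasurableSpace.comap (ctrlInfo N γu γθ t) inferInstance
    = MeasurableSpace.comap (arrivals N γu γθ t) inferInstance := by
  apply le_antisymm
  · refine Measurable.comap_le (Measurable.prodMk (comap_measurable (arrivals N γu γθ t)) ?_)
    exact measurable_tuple fun s => measurable_input_comap N γu γθ s.2.le
  · exact (measurable_fst.comp (comap_measurable (ctrlInfo N γu γθ t))).comap_le

/-- The estimate of the uncontrolled state given the arrivals. -/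
noncomputable def freeEstimate (t : ℕ) : Ω → Fin n → ℝ :=
  μ[freeState N t | MeasurableSpace.comap (arrivals N γu γθ t) inferInstance]

theorem estimate_ae_eq [IsFiniteMeasure μ] (t : ℕ) : estimate N γu γθ t =ᵐ[μ]
    fun ω => freeEstimate N γu γθ t ω + forcedState S t fun s => input N γu γθ s ω := by
  have hu : StronglyMeasurable[MeasurableSpace.comap (arrivals N γu γθ t) inferInstance]
      fun ω => forcedState S t fun s => input N γu γθ s ω :=
    ((measurable_forcedState t).comp (measurable_tuple fun s =>
        measurable_input_comap N γu γθ s.2.le)).stronglyMeasurable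
  have hu1 := (memLp_forcedState N γu γθ t 2).integrable one_le_two
  have h := condExp_add ((memLp_freeState N t).integrable one_le_two) hu1
    (MeasurableSpace.comap (arrivals N γu γθ t) inferInstance)
  rw [condExp_of_stronglyMeasurable (measurable_arrivals N γu γθ t).comap_le hu hu1] at h
  rw [estimate, comap_ctrlInfo, show state N γu γθ t = freeState N t
      + fun ω => forcedState S t fun s => input N γu γθ s ω from funext (state_eq N γu γθ t)]
  exact h

theorem estError_ae_eq [IsFiniteMeasure μ] (t : ℕ) :
    estError N γu γθ t =ᵐ[μ] fun ω => freeState N t ω - freeEstimate N γu γθ t ω := by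
  filter_upwards [estimate_ae_eq N γu γθ t] with ω hω
  rw [estError, Pi.sub_apply, hω, state_eq]
  abel

theorem arrivals_ae_eq [IsFiniteMeasure μ] (γu' : CtrlPolicy S) (t : ℕ) :
    arrivals N γu γθ t =ᵐ[μ] arrivals N γu' γθ t := by
  filter_upwards [ae_arrival_selection_eq N γu γθ γu'] with ω hω
  funext s
  exact (hω s).1

theorem selection_ae_eq [IsFiniteMeasure μ] (γu' : CtrlPolicy S) (t : ℕ) :
    selection N γu γθ t =ᵐ[μ] selection N γu' γθ t := by
  filter_upwards [ae_arrival_selection_eq N γu γθ γu'] with ω hω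
  exact (hω t).2

/-- Separation of estimation and control: the control policy has no influence on the error. -/
theorem estError_ae_eq_estError [IsFiniteMeasure μ] (γu' : CtrlPolicy S) (t : ℕ) :
    estError N γu γθ t =ᵐ[μ] estError N γu' γθ t := by
  have h : freeEstimate N γu γθ t =ᵐ[μ] freeEstimate N γu' γθ t :=
    condExp_comap_congr ((memLp_freeState N t).integrable one_le_two)
      (measurable_arrivals N γu γθ t) (measurable_arrivals N γu' γθ t)
      (arrivals_ae_eq N γu γθ γu' t)
  filter_upwards [estError_ae_eq N γu γθ t, estError_ae_eq N γu' γθ t, h] with ω h1 h2 h3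
  rw [h1, h2, h3]

theorem memLp_estimate [IsFiniteMeasure μ] (t : ℕ) : MemLp (estimate N γu γθ t) 2 μ :=
  (memLp_state N γu γθ t).condExp one_le_two

theorem memLp_estError [IsFiniteMeasure μ] (t : ℕ) : MemLp (estError N γu γθ t) 2 μ :=
  (memLp_state N γu γθ t).sub (memLp_estimate N γu γθ t)

/-- Certainty-equivalent control from time `k` on can be realized by an admissible policy, whatever
was done before. -/
theorem exists_certaintyEquivalent [IsFiniteMeasure μ] (T k : ℕ) : ∃ γu' : CtrlPolicy S,
    γu.AgreeBefore k γu' ∧ ∀ t, k ≤ t → IsCertaintyEquivalent N T t γu' γθ := by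
  -- The estimate of the uncontrolled state is a function `h t` of the arrivals, and this function
  -- does not depend on the control policy.
  have hfac (t : ℕ) : ∃ h : (Fin (t + 1) → Obs S) → Fin n → ℝ, StronglyMeasurable h ∧
      freeEstimate N γu γθ t = h ∘ arrivals N γu γθ t :=
    stronglyMeasurable_condExp.exists_eq_measurable_comp
  choose h hh hfac using hfac
  let γu' : CtrlPolicy S :=
    { act := fun t => if t < k then γu.act t else fun I =>
        -(S.gain T t *ᵥ (h t I.1 + forcedState S t I.2))
      measurable_act := fun t => by
        split_ifs
        · exact γu.measurable_act t
        · exact ((measurable_mulVec _).comp (((hh t).measurable.comp measurable_fst).add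
            ((measurable_forcedState t).comp measurable_snd))).neg }
  refine ⟨γu', fun t ht => if_pos ht, fun t ht => ?_⟩
  have hest : freeEstimate N γu' γθ t =ᵐ[μ] h t ∘ arrivals N γu' γθ t :=
    condExp_comap_of_ae_eq ((memLp_freeState N t).integrable one_le_two)
      (measurable_arrivals N γu γθ t) (measurable_arrivals N γu' γθ t)
      (arrivals_ae_eq N γu γθ γu' t) (hh t) (.of_eq (hfac t))
  filter_upwards [hest, estimate_ae_eq N γu' γθ t] with ω h1 h2
  rw [h2, h1, input_eq]
  simp only [γu', if_neg (not_lt.2 ht)]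
  rfl

end Estimate

/-! ### The past is independent of the present process noise -/

section Past

variable {n m p M : ℕ} {S : System n m p M} {Ω : Type*} [mΩ : MeasurableSpace Ω] {μ : Measure Ω}
  (N : Noise S μ) (γu : CtrlPolicy S) (γθ : SelPolicy S)

/-- The σ-algebras generated by the primitive random variables. -/
abbrev noiseAlgebra : Unit ⊕ (ℕ ⊕ ℕ) → MeasurableSpace Ω
  | .inl _ => MeasurableSpace.comap N.X₀ inferInstance
  | .inr (.inl t) => MeasurableSpace.comap (N.W t) inferInstance
  | .inr (.inr t) => MeasurableSpace.comap (N.V t) inferInstance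

/-- The σ-algebra generated by all the primitive random variables other than `W_t`. -/
abbrev otherNoise (t : ℕ) : MeasurableSpace Ω :=
  ⨆ i ∈ ({.inr (.inl t)}ᶜ : Set (Unit ⊕ (ℕ ⊕ ℕ))), noiseAlgebra N i

theorem noiseAlgebra_le (i : Unit ⊕ (ℕ ⊕ ℕ)) : noiseAlgebra N i ≤ mΩ := by
  rcases i with _ | t | t
  · exact N.measurable_X₀.comap_le
  · exact (N.measurable_W t).comap_le
  · exact (N.measurable_V t).comap_le

theorem indep_otherNoise (t : ℕ) :
    Indep (MeasurableSpace.comap (N.W t) inferInstance) (otherNoise N t) μ := by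
  have h : iIndep (noiseAlgebra N) μ := by
    convert N.indep using 2
  have h' := indep_iSup_of_disjoint (noiseAlgebra_le N) h
    (disjoint_compl_right (a := ({.inr (.inl t)} : Set (Unit ⊕ (ℕ ⊕ ℕ)))))
  exact indep_of_indep_of_le_left h' (le_iSup₂_of_le (.inr (.inl t)) rfl le_rfl)

theorem noiseAlgebra_le_otherNoise {t : ℕ} {i : Unit ⊕ (ℕ ⊕ ℕ)} (h : i ≠ .inr (.inl t)) :
    noiseAlgebra N i ≤ otherNoise N t :=
  le_iSup₂_of_le i h le_rfl

theorem measurable_freeState_otherNoise {s t : ℕ} (h : s ≤ t) :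
    Measurable[otherNoise N t] (freeState N s) := by
  induction s with
  | zero =>
    exact (comap_measurable N.X₀).mono
      (noiseAlgebra_le_otherNoise N (i := .inl ()) (by simp)) le_rfl
  | succ s ih =>
    refine ((measurable_mulVec S.A).comp (ih (by omega))).add ?_
    exact (comap_measurable (N.W s)).mono
      (noiseAlgebra_le_otherNoise N (i := .inr (.inl s)) (by simp; omega)) le_rfl

theorem freeHistory_le_otherNoise (t : ℕ) : freeHistory N (t + 1) ≤ otherNoise N t := by
  refine Measurable.comap_le (measurable_tuple fun s => ?_)
  refine ((measurable_mulVec S.C).comp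
    (measurable_freeState_otherNoise N (Nat.lt_succ_iff.1 s.2))).add ?_
  exact (comap_measurable (N.V s)).mono
    (noiseAlgebra_le_otherNoise N (i := .inr (.inr s)) (by simp)) le_rfl

theorem measurable_input_otherNoise {s t : ℕ} (h : s ≤ t) :
    Measurable[otherNoise N t] (input N γu γθ s) :=
  (measurable_input_freeHistory N γu γθ (Nat.lt_succ_iff.2 h)).mono
    (freeHistory_le_otherNoise N t) le_rfl

theorem measurable_state_otherNoise (t : ℕ) : Measurable[otherNoise N t] (state N γu γθ t) := by
  rw [funext (state_eq N γu γθ t)]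
  exact (measurable_freeState_otherNoise N le_rfl).add ((measurable_forcedState t).comp
    (measurable_tuple fun s => measurable_input_otherNoise N γu γθ s.2.le))

theorem integral_noise_dotProduct [IsFiniteMeasure μ] (P : Matrix (Fin n) (Fin n) ℝ) (t : ℕ) :
    ∫ ω, N.W t ω ⬝ᵥ P *ᵥ (S.A *ᵥ state N γu γθ t ω + S.B *ᵥ input N γu γθ t ω) ∂μ = 0 := by
  have hv : Measurable[otherNoise N t]
      fun ω => P *ᵥ (S.A *ᵥ state N γu γθ t ω + S.B *ᵥ input N γu γθ t ω) :=
    (measurable_mulVec P).comp (((measurable_mulVec S.A).comp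
      (measurable_state_otherNoise N γu γθ t)).add ((measurable_mulVec S.B).comp
      (measurable_input_otherNoise N γu γθ le_rfl)))
  have hv' : MemLp (fun ω => P *ᵥ (S.A *ᵥ state N γu γθ t ω + S.B *ᵥ input N γu γθ t ω)) 2 μ :=
    memLp_mulVec ((memLp_mulVec (memLp_state N γu γθ t) S.A).add
      (memLp_mulVec (memLp_input N γu γθ t 2) S.B)) P
  refine integral_dotProduct_eq_zero_of_indep (N.measurable_W t) (fun i => ?_)
    (indep_otherNoise N t) hv (fun i => ?_) (hv.mono (iSup₂_le fun i _ => noiseAlgebra_le N i)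
      le_rfl)
  · rw [integral_eq_of_hasLaw_gaussian (N.law_W t)]
    rfl
  · exact (memLp_apply (memLp_of_hasLaw_gaussian (N.law_W t)) i).integrable_mul
      (memLp_apply hv' i)

theorem integral_noise_quadForm (P : Matrix (Fin n) (Fin n) ℝ) (t : ℕ) :
    ∫ ω, N.W t ω ⬝ᵥ P *ᵥ N.W t ω ∂μ = (P * S.covW).trace :=
  integral_quadForm (memLp_of_hasLaw_gaussian (N.law_W t)) P S.covW
    (integral_mul_of_hasLaw_gaussian S.posSemidef_covW (N.law_W t))

end Past

/-! ### One step of dynamic programming -/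

section OneStep

variable {n m p M : ℕ} {S : System n m p M} {Ω : Type*} [mΩ : MeasurableSpace Ω] {μ : Measure Ω}
  (N : Noise S μ) (T : ℕ) (γu : CtrlPolicy S) (γθ : SelPolicy S)

/-- The deviation `U_t + L_t E[X_t | I^c_t]` of the control from certainty equivalence. -/
noncomputable def deviation (t : ℕ) (ω : Ω) : Fin m → ℝ :=
  input N γu γθ t ω + S.gain T t *ᵥ estimate N γu γθ t ω

/-- The expected loss caused by the deviation from certainty equivalence at time `t`. -/
noncomputable def gap (t : ℕ) : ℝ≥0∞ :=
  ∫⁻ ω, ENNReal.ofReal (deviation N T γu γθ t ω ⬝ᵥ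
    S.ctrlWeight T t *ᵥ deviation N T γu γθ t ω) ∂μ

/-- The expected cost `E[X_tᵀ P_t X_t]` of the state at time `t`. -/
noncomputable def stateCost (t : ℕ) : ℝ≥0∞ :=
  ∫⁻ ω, ENNReal.ofReal (state N γu γθ t ω ⬝ᵥ S.riccati T t *ᵥ state N γu γθ t ω) ∂μ

/-- The cost `e_tᵀ N_t e_t + θ_tᵀ Λ` of estimation error and quantizer at time `t`. -/
noncomputable def selStage (t : ℕ) (ω : Ω) : ℝ :=
  estError N γu γθ t ω ⬝ᵥ S.errorWeight T t *ᵥ estError N γu γθ t ω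
    + S.price (selection N γu γθ t ω)

theorem selStage_nonneg (t : ℕ) (ω : Ω) : 0 ≤ selStage N T γu γθ t ω :=
  add_nonneg (S.quadForm_errorWeight_nonneg T t _) (NNReal.coe_nonneg _)

theorem stageCost_nonneg (t : ℕ) (ω : Ω) : 0 ≤ stageCost N γu γθ t ω :=
  add_nonneg (add_nonneg (quadForm_nonneg S.posSemidef_Q₁ _)
    (quadForm_nonneg S.posDef_R.posSemidef _)) (NNReal.coe_nonneg _)

theorem integrable_price [IsFiniteMeasure μ] (t : ℕ) :
    Integrable (fun ω => (S.price (selection N γu γθ t ω) : ℝ)) μ := by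
  obtain ⟨c, hc⟩ := (Set.finite_range fun i => (S.price i : ℝ)).isBounded.exists_norm_le
  exact Integrable.of_bound ((measurable_of_countable fun i => (S.price i : ℝ)).comp
    (measurable_selection N γu γθ t)).aestronglyMeasurable c (.of_forall fun ω => hc _ ⟨_, rfl⟩)

variable [IsFiniteMeasure μ]

theorem memLp_deviation (t : ℕ) : MemLp (deviation N T γu γθ t) 2 μ :=
  (memLp_input N γu γθ t 2).add (memLp_mulVec (memLp_estimate N γu γθ t) _)

theorem integrable_selStage (t : ℕ) : Integrable (selStage N T γu γθ t) μ :=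
  (integrable_dotProduct (memLp_estError N γu γθ t) (memLp_mulVec (memLp_estError N γu γθ t) _)).add
    (integrable_price N γu γθ t)

theorem integrable_state_quadForm (P : Matrix (Fin n) (Fin n) ℝ) (t : ℕ) :
    Integrable (fun ω => state N γu γθ t ω ⬝ᵥ P *ᵥ state N γu γθ t ω) μ :=
  integrable_dotProduct (memLp_state N γu γθ t) (memLp_mulVec (memLp_state N γu γθ t) P)

theorem integrable_stageCost (t : ℕ) : Integrable (stageCost N γu γθ t) μ :=
  ((integrable_state_quadForm N γu γθ S.Q₁ t).add (integrable_dotProduct (memLp_input N γu γθ t 2)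
    (memLp_mulVec (memLp_input N γu γθ t 2) S.R))).add (integrable_price N γu γθ t)

theorem integrable_deviation_quadForm (t : ℕ) : Integrable (fun ω => deviation N T γu γθ t ω ⬝ᵥ
    S.ctrlWeight T t *ᵥ deviation N T γu γθ t ω) μ :=
  integrable_dotProduct (memLp_deviation N T γu γθ t) (memLp_mulVec (memLp_deviation N T γu γθ t) _)

theorem stateCost_ne_top (t : ℕ) : stateCost N T γu γθ t ≠ ⊤ :=
  (integrable_state_quadForm N γu γθ _ t).lintegral_lt_top.ne

/-- The gap vanishes exactly for certainty-equivalent control because `R + Bᵀ P B` is positive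
definite. -/
theorem gap_eq_zero_iff (t : ℕ) :
    gap N T γu γθ t = 0 ↔ IsCertaintyEquivalent N T t γu γθ := by
  rw [gap, lintegral_eq_zero_iff'
    (integrable_deviation_quadForm N T γu γθ t).aestronglyMeasurable.aemeasurable.ennreal_ofReal]
  refine Filter.eventually_congr (.of_forall fun ω => ?_)
  rw [Pi.zero_apply, ENNReal.ofReal_eq_zero, ← add_eq_zero_iff_eq_neg]
  change _ ↔ deviation N T γu γθ t ω = 0
  refine ⟨fun h => ?_, fun h => by rw [h, zero_dotProduct]⟩
  by_contra hne
  have := (S.ctrlWeight_posDef T t).dotProduct_mulVec_pos hne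
  rw [star_trivial] at this
  exact absurd h (not_le.2 this)

/-- The control deviates from certainty equivalence in a direction known to the controller, hence
orthogonal to the estimation error. -/
theorem integral_deviation_estError (P : Matrix (Fin n) (Fin m) ℝ) (t : ℕ) :
    ∫ ω, (P *ᵥ deviation N T γu γθ t ω) ⬝ᵥ estError N γu γθ t ω ∂μ = 0 := by
  have hin : Measurable[MeasurableSpace.comap (ctrlInfo N γu γθ t) inferInstance]
      (input N γu γθ t) := by
    rw [comap_ctrlInfo]
    exact measurable_input_comap N γu γθ le_rfl
  have hv : Measurable[MeasurableSpace.comap (ctrlInfo N γu γθ t) inferInstance]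
      fun ω => P *ᵥ deviation N T γu γθ t ω :=
    (measurable_mulVec P).comp (hin.add ((measurable_mulVec _).comp
      stronglyMeasurable_condExp.measurable))
  exact integral_dotProduct_sub_condExp (measurable_ctrlInfo N γu γθ t).comap_le
    (memLp_state N γu γθ t) hv.stronglyMeasurable (memLp_mulVec (memLp_deviation N T γu γθ t) P)

omit [IsFiniteMeasure μ] in
/-- The completed square along the closed loop, expanded around the estimate of the state. -/
theorem stageCost_add_riccati {k : ℕ} (hk : k < T) (ω : Ω) :
    stageCost N γu γθ k ω
        + state N γu γθ (k + 1) ω ⬝ᵥ S.riccati T (k + 1) *ᵥ state N γu γθ (k + 1) ω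
      = state N γu γθ k ω ⬝ᵥ S.riccati T k *ᵥ state N γu γθ k ω
        + deviation N T γu γθ k ω ⬝ᵥ S.ctrlWeight T k *ᵥ deviation N T γu γθ k ω
        + selStage N T γu γθ k ω
        + N.W k ω ⬝ᵥ S.riccati T (k + 1) *ᵥ N.W k ω
        + 2 * (N.W k ω ⬝ᵥ S.riccati T (k + 1) *ᵥ
            (S.A *ᵥ state N γu γθ k ω + S.B *ᵥ input N γu γθ k ω))
        + 2 * ((((S.gain T k)ᵀ * S.ctrlWeight T k) *ᵥ deviation N T γu γθ k ω) ⬝ᵥ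
            estError N γu γθ k ω) := by
  have hsq := S.completeSquare_riccati hk (state N γu γθ k ω) (input N γu γθ k ω)
  have hdev : input N γu γθ k ω + S.gain T k *ᵥ state N γu γθ k ω
      = deviation N T γu γθ k ω + S.gain T k *ᵥ estError N γu γθ k ω := by
    rw [deviation, estError, Pi.sub_apply, mulVec_sub]
    abel
  have hP := transpose_eq_of_posSemidef (S.riccati_posSemidef T (k + 1))
  have hG := transpose_eq_of_posSemidef (S.ctrlWeight_posDef T k).posSemidef
  have hcross : (((S.gain T k)ᵀ * S.ctrlWeight T k) *ᵥ deviation N T γu γθ k ω) ⬝ᵥ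
      estError N γu γθ k ω
      = deviation N T γu γθ k ω ⬝ᵥ S.ctrlWeight T k *ᵥ (S.gain T k *ᵥ estError N γu γθ k ω) := by
    rw [dotProduct_mulVec_comm hG, ← mulVec_mulVec, dotProduct_comm,
      dotProduct_mulVec (estError N γu γθ k ω), vecMul_transpose]
  rw [hdev] at hsq
  simp only [mulVec_add (S.ctrlWeight T k), add_dotProduct (deviation N T γu γθ k ω),
    dotProduct_add (deviation N T γu γθ k ω), dotProduct_add (S.gain T k *ᵥ _)] at hsq
  rw [dotProduct_mulVec_comm hG (S.gain T k *ᵥ _) (deviation N T γu γθ k ω),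
    ← S.quadForm_errorWeight] at hsq
  rw [stageCost, selStage, state_succ, hcross]
  generalize S.A *ᵥ state N γu γθ k ω + S.B *ᵥ input N γu γθ k ω = a at hsq ⊢
  simp only [mulVec_add, add_dotProduct a, dotProduct_add a, dotProduct_add (N.W k ω)]
  rw [dotProduct_mulVec_comm hP a (N.W k ω)]
  linarith

/-- The expected form of the completed square: the cross terms vanish since `W_k` is independent of
the past, and since the estimation error is orthogonal to what the controller knows. -/
theorem integral_oneStep {k : ℕ} (hk : k < T) :
    ∫ ω, stageCost N γu γθ k ω ∂μ
        + ∫ ω, state N γu γθ (k + 1) ω ⬝ᵥ S.riccati T (k + 1) *ᵥ state N γu γθ (k + 1) ω ∂μ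
      = ∫ ω, state N γu γθ k ω ⬝ᵥ S.riccati T k *ᵥ state N γu γθ k ω ∂μ
        + ∫ ω, deviation N T γu γθ k ω ⬝ᵥ S.ctrlWeight T k *ᵥ deviation N T γu γθ k ω ∂μ
        + ∫ ω, selStage N T γu γθ k ω ∂μ + (S.riccati T (k + 1) * S.covW).trace := by
  have hW : MemLp (N.W k) 2 μ := memLp_of_hasLaw_gaussian (N.law_W k)
  have ha : MemLp (fun ω => S.A *ᵥ state N γu γθ k ω + S.B *ᵥ input N γu γθ k ω) 2 μ :=
    (memLp_mulVec (memLp_state N γu γθ k) S.A).add (memLp_mulVec (memLp_input N γu γθ k 2) S.B)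
  have i1 := integrable_state_quadForm N γu γθ (S.riccati T k) k
  have i2 := i1.add (integrable_deviation_quadForm N T γu γθ k)
  have i3 := i2.add (integrable_selStage N T γu γθ k)
  have iW := integrable_dotProduct hW (memLp_mulVec hW (S.riccati T (k + 1)))
  have i4 := i3.add iW
  have iWa := (integrable_dotProduct hW (memLp_mulVec ha (S.riccati T (k + 1)))).const_mul 2
  have i5 := i4.add iWa
  have ie := (integrable_dotProduct (memLp_mulVec (memLp_deviation N T γu γθ k)
    ((S.gain T k)ᵀ * S.ctrlWeight T k)) (memLp_estError N γu γθ k)).const_mul 2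
  rw [← integral_add (integrable_stageCost N γu γθ k) (integrable_state_quadForm N γu γθ _ (k + 1)),
    integral_congr_ae (.of_forall (stageCost_add_riccati N T γu γθ hk))]
  refine (integral_add i5 ie).trans ?_
  rw [integral_const_mul, integral_deviation_estError, mul_zero, add_zero]
  refine (integral_add i4 iWa).trans ?_
  rw [integral_const_mul, integral_noise_dotProduct, mul_zero, add_zero]
  refine (integral_add i3 iW).trans ?_
  rw [integral_noise_quadForm]
  congr 1
  refine (integral_add i2 (integrable_selStage N T γu γθ k)).trans ?_
  congr 1
  exact integral_add i1 (integrable_deviation_quadForm N T γu γθ k)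

omit [IsFiniteMeasure μ] in
theorem trace_riccati_mul_nonneg (N : Noise S μ) (T k : ℕ) :
    0 ≤ (S.riccati T k * S.covW).trace := by
  rw [← integral_noise_quadForm N _ 0]
  exact integral_nonneg fun ω => quadForm_nonneg (S.riccati_posSemidef T k) _

theorem lintegral_oneStep {k : ℕ} (hk : k < T) :
    ∫⁻ ω, ENNReal.ofReal (stageCost N γu γθ k ω) ∂μ + stateCost N T γu γθ (k + 1)
      = stateCost N T γu γθ k + gap N T γu γθ k
        + ∫⁻ ω, ENNReal.ofReal (selStage N T γu γθ k ω) ∂μ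
        + ENNReal.ofReal (S.riccati T (k + 1) * S.covW).trace := by
  have hx (t : ℕ) (ω : Ω) := quadForm_nonneg (S.riccati_posSemidef T t) (state N γu γθ t ω)
  have hd (ω : Ω) := quadForm_nonneg (S.ctrlWeight_posDef T k).posSemidef
    (deviation N T γu γθ k ω)
  have hs := stageCost_nonneg N γu γθ k
  have he := selStage_nonneg N T γu γθ k
  rw [stateCost, stateCost, gap,
    ← ofReal_integral_eq_lintegral_ofReal (integrable_stageCost N γu γθ k) (.of_forall hs),
    ← ofReal_integral_eq_lintegral_ofReal (integrable_state_quadForm N γu γθ _ k)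
      (.of_forall (hx k)),
    ← ofReal_integral_eq_lintegral_ofReal (integrable_state_quadForm N γu γθ _ (k + 1))
      (.of_forall (hx (k + 1))),
    ← ofReal_integral_eq_lintegral_ofReal (integrable_deviation_quadForm N T γu γθ k)
      (.of_forall hd),
    ← ofReal_integral_eq_lintegral_ofReal (integrable_selStage N T γu γθ k) (.of_forall he),
    ← ENNReal.ofReal_add (integral_nonneg hs) (integral_nonneg (hx (k + 1))),
    integral_oneStep N T γu γθ hk,
    ENNReal.ofReal_add (add_nonneg (add_nonneg (integral_nonneg (hx k)) (integral_nonneg hd))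
      (integral_nonneg he)) (trace_riccati_mul_nonneg N T (k + 1)),
    ENNReal.ofReal_add (add_nonneg (integral_nonneg (hx k)) (integral_nonneg hd))
      (integral_nonneg he), ENNReal.ofReal_add (integral_nonneg (hx k)) (integral_nonneg hd)]

end OneStep

/-! ### The cost from time `k` on -/

section Cost

variable {n m p M : ℕ} {S : System n m p M} {Ω : Type*} [mΩ : MeasurableSpace Ω] {μ : Measure Ω}
  [IsFiniteMeasure μ] (N : Noise S μ) (T : ℕ) (γu : CtrlPolicy S) (γθ : SelPolicy S)

omit [IsFiniteMeasure μ] in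
theorem costFrom_terminal : costFrom N T T γu γθ = stateCost N T γu γθ T := by
  simp [costFrom, stateCost, S.riccati_terminal]

theorem costFrom_of_lt {k : ℕ} (hk : k < T) : costFrom N T k γu γθ
    = ∫⁻ ω, ENNReal.ofReal (stageCost N γu γθ k ω) ∂μ + costFrom N T (k + 1) γu γθ := by
  rw [costFrom, costFrom, ← lintegral_add_left'
    (integrable_stageCost N γu γθ k).aestronglyMeasurable.aemeasurable.ennreal_ofReal]
  refine lintegral_congr fun ω => ?_
  rw [← ENNReal.ofReal_add (stageCost_nonneg N γu γθ k ω) (add_nonneg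
    (Finset.sum_nonneg fun t _ => stageCost_nonneg N γu γθ t ω)
    (quadForm_nonneg S.posSemidef_Q₂ _)), Finset.sum_eq_sum_Ico_succ_bot hk, add_assoc]

theorem selCost_of_lt {k : ℕ} (hk : k < T) : selCost N T k γu γθ
    = ∫⁻ ω, ENNReal.ofReal (selStage N T γu γθ k ω) ∂μ + selCost N T (k + 1) γu γθ := by
  rw [selCost, selCost, ← lintegral_add_left'
    (integrable_selStage N T γu γθ k).aestronglyMeasurable.aemeasurable.ennreal_ofReal]
  refine lintegral_congr fun ω => ?_
  rw [Finset.sum_eq_sum_Ico_succ_bot hk]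
  exact ENNReal.ofReal_add (selStage_nonneg N T γu γθ k ω)
    (Finset.sum_nonneg fun t _ => selStage_nonneg N T γu γθ t ω)

omit [IsFiniteMeasure μ] in
theorem ofReal_residual_of_lt (N : Noise S μ) (T : ℕ) {k : ℕ} (hk : k < T) :
    ENNReal.ofReal (residual S T k) = ENNReal.ofReal (S.riccati T (k + 1) * S.covW).trace
      + ENNReal.ofReal (residual S T (k + 1)) := by
  rw [residual, Finset.sum_eq_sum_Ico_succ_bot hk]
  exact ENNReal.ofReal_add (trace_riccati_mul_nonneg N T _)
    (Finset.sum_nonneg fun t _ => trace_riccati_mul_nonneg N T _)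

/-- The decomposition of the cost. Only the last sum depends on the controls from time `k` on. -/
theorem costFrom_eq {k : ℕ} (hk : k ≤ T) : costFrom N T k γu γθ
    = stateCost N T γu γθ k + selCost N T k γu γθ + ENNReal.ofReal (residual S T k)
      + ∑ t ∈ Finset.Ico k T, gap N T γu γθ t := by
  induction hk using Nat.decreasingInduction with
  | self => simp [costFrom_terminal, selCost, residual]
  | of_succ k hk ih =>
    rw [costFrom_of_lt N T γu γθ hk, ih, selCost_of_lt N T γu γθ hk, ofReal_residual_of_lt N T hk,
      Finset.sum_eq_sum_Ico_succ_bot hk, ← add_assoc, ← add_assoc, ← add_assoc,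
      lintegral_oneStep N T γu γθ hk]
    ring

theorem selCost_ne_top (k : ℕ) : selCost N T k γu γθ ≠ ⊤ :=
  (integrable_finsetSum (Finset.Ico k T) fun t _ =>
    integrable_selStage N T γu γθ t).lintegral_lt_top.ne

theorem lintegral_selStage_congr (γu' : CtrlPolicy S) (t : ℕ) :
    ∫⁻ ω, ENNReal.ofReal (selStage N T γu γθ t ω) ∂μ
      = ∫⁻ ω, ENNReal.ofReal (selStage N T γu' γθ t ω) ∂μ := by
  refine lintegral_congr_ae ?_
  filter_upwards [estError_ae_eq_estError N γu γθ γu' t, selection_ae_eq N γu γθ γu' t] with ω h h'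
  rw [selStage, selStage, h, h']

/-- The control policy has no influence on the cost of estimation and of quantization. -/
theorem selCost_congr (γu' : CtrlPolicy S) (k : ℕ) :
    selCost N T k γu γθ = selCost N T k γu' γθ := by
  have h : ∀ᵐ ω ∂μ, ∀ t, estError N γu γθ t ω = estError N γu' γθ t ω :=
    ae_all_iff.2 fun t => estError_ae_eq_estError N γu γθ γu' t
  refine lintegral_congr_ae ?_
  filter_upwards [h, ae_arrival_selection_eq N γu γθ γu'] with ω h1 h2
  simp only [h1, (h2 _).2]

theorem selValue_congr (γu' : CtrlPolicy S) (k : ℕ) :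
    selValue N T k γu γθ = selValue N T k γu' γθ := by
  simp only [selValue, selCost_congr N T γu _ γu']

omit [IsFiniteMeasure μ] in
theorem selCost_congr_of_agree {γθ' : SelPolicy S} (h : γθ.AgreeBefore T γθ') (k : ℕ) :
    selCost N T k γu γθ' = selCost N T k γu γθ := by
  refine lintegral_congr fun ω => congrArg _ (Finset.sum_congr rfl fun t ht => ?_)
  have ht' := (Finset.mem_Ico.1 ht).2
  rw [estError_congr N (fun _ _ => rfl) h ht', (loop_congr N (fun _ _ => rfl) h t ht').1]

omit [IsFiniteMeasure μ] in
/-- The optimal selection exists, since up to time `T` there are only finitely many selection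
policies: they are maps between finite sets. -/
theorem isLeast_selValue (k : ℕ) : IsLeast {v | ∃ γθ' : SelPolicy S, γθ.AgreeBefore k γθ' ∧
    v = selCost N T k γu γθ'} (selValue N T k γu γθ) := by
  let restr : SelPolicy S → (t : Fin T) → SelInfo S t → Fin M := fun γ t => γ.act t
  have hfac : (selCost N T k γu).FactorsThrough restr := fun γ γ' h =>
    (selCost_congr_of_agree N T γu γ (fun t ht => (congrFun h ⟨t, ht⟩).symm) k).symm
  have hfin : (Set.range (selCost N T k γu)).Finite := by
    rw [← hfac.extend_comp fun _ => 0]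
    exact (Set.finite_range _).subset (Set.range_comp_subset_range _ _)
  have hne : {v | ∃ γθ' : SelPolicy S, γθ.AgreeBefore k γθ' ∧
      v = selCost N T k γu γθ'}.Nonempty := ⟨_, γθ, fun _ _ => rfl, rfl⟩
  have hmem := hne.csInf_mem (hfin.subset (by rintro _ ⟨γ, -, rfl⟩; exact ⟨γ, rfl⟩))
  exact ⟨hmem, fun v hv => sInf_le hv⟩

omit [IsFiniteMeasure μ] in
theorem stateCost_congr {γu' : CtrlPolicy S} {γθ' : SelPolicy S} {k : ℕ}
    (hu : γu.AgreeBefore k γu') (hθ : γθ.AgreeBefore k γθ') :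
    stateCost N T γu' γθ' k = stateCost N T γu γθ k := by
  rw [stateCost, stateCost, state_congr N hu hθ le_rfl]

/-- The best that can be done from time `k` on: optimal selection combined with
certainty-equivalent control. -/
theorem isLeast_costFrom {k : ℕ} (hk : k ≤ T) :
    IsLeast {v | ∃ (γu' : CtrlPolicy S) (γθ' : SelPolicy S), γu.AgreeBefore k γu' ∧
      γθ.AgreeBefore k γθ' ∧ v = costFrom N T k γu' γθ'}
      (stateCost N T γu γθ k + selValue N T k γu γθ + ENNReal.ofReal (residual S T k)) := by
  obtain ⟨⟨γθ', hθ, hγθ'⟩, hmin⟩ := isLeast_selValue N T γu γθ k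
  obtain ⟨γu', hu, hce⟩ := exists_certaintyEquivalent N γu γθ' T k
  refine ⟨⟨γu', γθ', hu, hθ, ?_⟩, ?_⟩
  · rw [costFrom_eq N T γu' γθ' hk, stateCost_congr N T γu γθ hu hθ, selCost_congr N T γu' γθ' γu,
      Finset.sum_eq_zero fun t ht => (gap_eq_zero_iff N T γu' γθ' t).2
        (hce t (Finset.mem_Ico.1 ht).1), hγθ', add_zero]
  · rintro _ ⟨γu'', γθ'', hu'', hθ'', rfl⟩
    rw [costFrom_eq N T γu'' γθ'' hk, stateCost_congr N T γu γθ hu'' hθ'',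
      selCost_congr N T γu'' γθ'' γu]
    refine le_add_right ?_
    gcongr
    exact hmin ⟨γθ'', hθ'', rfl⟩

theorem value_eq {k : ℕ} (hk : k ≤ T) : value N T k γu γθ
    = stateCost N T γu γθ k + selValue N T k γu γθ + ENNReal.ofReal (residual S T k) :=
  (isLeast_costFrom N T γu γθ hk).csInf_eq

theorem isLeast_value {k : ℕ} (hk : k ≤ T) :
    IsLeast {v | ∃ (γu' : CtrlPolicy S) (γθ' : SelPolicy S), γu.AgreeBefore k γu' ∧
      γθ.AgreeBefore k γθ' ∧ v = costFrom N T k γu' γθ'} (value N T k γu γθ) :=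
  value_eq N T γu γθ hk ▸ isLeast_costFrom N T γu γθ hk

theorem selValue_ne_top (k : ℕ) : selValue N T k γu γθ ≠ ⊤ := by
  obtain ⟨γθ', -, h⟩ := (isLeast_selValue N T γu γθ k).1
  exact h ▸ selCost_ne_top N T γu γθ' k

theorem value_ne_top {k : ℕ} (hk : k ≤ T) : value N T k γu γθ ≠ ⊤ := by
  rw [value_eq N T γu γθ hk]
  exact ENNReal.add_ne_top.2 ⟨ENNReal.add_ne_top.2 ⟨stateCost_ne_top N T γu γθ k,
    selValue_ne_top N T γu γθ k⟩, ENNReal.ofReal_ne_top⟩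

/-- The dynamic programming equation. -/
theorem isLeast_bellman {k : ℕ} (hk : k < T) :
    IsLeast {v | ∃ (γu' : CtrlPolicy S) (γθ' : SelPolicy S), γu.AgreeBefore k γu' ∧
      γθ.AgreeBefore k γθ' ∧ v = bellman N T k γu' γθ'} (value N T k γu γθ) := by
  have hlower : value N T k γu γθ ∈ lowerBounds {v | ∃ (γu' : CtrlPolicy S) (γθ' : SelPolicy S),
      γu.AgreeBefore k γu' ∧ γθ.AgreeBefore k γθ' ∧ v = bellman N T k γu' γθ'} := by
    rintro _ ⟨γu', γθ', hu, hθ, rfl⟩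
    obtain ⟨γu'', γθ'', hu', hθ', h⟩ := (isLeast_value N T γu' γθ' hk).1
    rw [bellman, h, ← stageCost_congr N hu' hθ' k.lt_succ_self, ← costFrom_of_lt N T γu'' γθ'' hk]
    exact (isLeast_value N T γu γθ hk.le).2 ⟨γu'', γθ'',
      fun t ht => (hu' t (ht.trans k.lt_succ_self)).trans (hu t ht),
      fun t ht => (hθ' t (ht.trans k.lt_succ_self)).trans (hθ t ht), rfl⟩
  refine ⟨?_, hlower⟩
  obtain ⟨γu', γθ', hu, hθ, h⟩ := (isLeast_value N T γu γθ hk.le).1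
  refine ⟨γu', γθ', hu, hθ, le_antisymm (hlower ⟨γu', γθ', hu, hθ, rfl⟩) ?_⟩
  rw [h, costFrom_of_lt N T γu' γθ' hk, bellman]
  gcongr
  exact (isLeast_value N T γu' γθ' hk).2 ⟨γu', γθ', fun _ _ => rfl, fun _ _ => rfl, rfl⟩

theorem bellman_eq {k : ℕ} (hk : k < T) : bellman N T k γu γθ = gap N T γu γθ k
    + (stateCost N T γu γθ k + ∫⁻ ω, ENNReal.ofReal (selStage N T γu γθ k ω) ∂μ
      + selValue N T (k + 1) γu γθ + ENNReal.ofReal (residual S T k)) := by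
  rw [bellman, value_eq N T γu γθ hk, ← add_assoc, ← add_assoc, lintegral_oneStep N T γu γθ hk,
    ofReal_residual_of_lt N T hk]
  ring

theorem bellman_minimal_iff {k : ℕ} (hk : k < T) :
    (∀ γu' : CtrlPolicy S, γu.AgreeBefore k γu' → bellman N T k γu γθ ≤ bellman N T k γu' γθ) ↔
      IsCertaintyEquivalent N T k γu γθ := by
  have hrest (γu' : CtrlPolicy S) (hu : γu.AgreeBefore k γu') : bellman N T k γu' γθ
      = gap N T γu' γθ k
        + (stateCost N T γu γθ k + ∫⁻ ω, ENNReal.ofReal (selStage N T γu γθ k ω) ∂μ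
          + selValue N T (k + 1) γu γθ + ENNReal.ofReal (residual S T k)) := by
    rw [bellman_eq N T γu' γθ hk, stateCost_congr N T γu γθ hu (fun _ _ => rfl),
      lintegral_selStage_congr N T γu' γθ γu, selValue_congr N T γu' γθ γu]
  have hfin : stateCost N T γu γθ k + ∫⁻ ω, ENNReal.ofReal (selStage N T γu γθ k ω) ∂μ
      + selValue N T (k + 1) γu γθ + ENNReal.ofReal (residual S T k) ≠ ⊤ := by
    simp only [ENNReal.add_ne_top]
    exact ⟨⟨⟨stateCost_ne_top N T γu γθ k, (integrable_selStage N T γu γθ k).lintegral_lt_top.ne⟩,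
      selValue_ne_top N T γu γθ _⟩, ENNReal.ofReal_ne_top⟩
  rw [← gap_eq_zero_iff]
  constructor
  · intro h
    obtain ⟨γu', hu, hce⟩ := exists_certaintyEquivalent N γu γθ T k
    have h' := h γu' hu
    rw [hrest γu' hu, hrest γu fun _ _ => rfl, (gap_eq_zero_iff N T γu' γθ k).2 (hce k le_rfl),
      ENNReal.add_le_add_iff_right hfin] at h'
    exact le_antisymm h' zero_le
  · intro h γu' hu
    rw [hrest γu' hu, hrest γu fun _ _ => rfl, h]
    gcongr
    exact zero_le

theorem cost_minimal_iff : (∀ γu' : CtrlPolicy S, cost N T γu γθ ≤ cost N T γu' γθ) ↔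
    ∀ k < T, IsCertaintyEquivalent N T k γu γθ := by
  have hcost (γu' : CtrlPolicy S) : cost N T γu' γθ = ∑ t ∈ Finset.Ico 0 T, gap N T γu' γθ t
      + (stateCost N T γu γθ 0 + selCost N T 0 γu γθ + ENNReal.ofReal (residual S T 0)) := by
    rw [cost, costFrom_eq N T γu' γθ T.zero_le, selCost_congr N T γu' γθ γu, add_comm,
      stateCost_congr N T γu γθ (fun _ h => absurd h (Nat.not_lt_zero _)) (fun _ _ => rfl)]
  have hfin : stateCost N T γu γθ 0 + selCost N T 0 γu γθ
      + ENNReal.ofReal (residual S T 0) ≠ ⊤ := by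
    simp only [ENNReal.add_ne_top]
    exact ⟨⟨stateCost_ne_top N T γu γθ 0, selCost_ne_top N T γu γθ 0⟩, ENNReal.ofReal_ne_top⟩
  have hsum (γu' : CtrlPolicy S) : ∑ t ∈ Finset.Ico 0 T, gap N T γu' γθ t = 0 ↔
      ∀ k < T, IsCertaintyEquivalent N T k γu' γθ := by
    simp only [Finset.sum_eq_zero_iff, gap_eq_zero_iff, Finset.mem_Ico, Nat.zero_le, true_and]
  rw [← hsum]
  constructor
  · intro h
    obtain ⟨γu', -, hce⟩ := exists_certaintyEquivalent N γu γθ T 0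
    have h' := h γu'
    rw [hcost γu, hcost γu', (hsum γu').2 fun k _ => hce k k.zero_le,
      ENNReal.add_le_add_iff_right hfin] at h'
    exact le_antisymm h' zero_le
  · intro h γu'
    rw [hcost γu, hcost γu', h]
    gcongr
    exact zero_le

end Cost

end QFLQG

open QFLQG in
theorem theorem1 {n m p M : ℕ} [NeZero M] (S : System n m p M)
    {Ω : Type*} [MeasurableSpace Ω] (μ : Measure Ω) [IsProbabilityMeasure μ]
    (N : Noise S μ) (T : ℕ) :
    -- the Riccati recursion is well posed
    (∀ k ≤ T, (S.riccati T k).PosSemidef) ∧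
    (∀ k < T, (S.R + S.Bᵀ * S.riccati T (k + 1) * S.B).PosDef) ∧
    -- for each selection policy, the certainty-equivalent control is admissible, and it is
    -- optimal for the performance index, and it is the only optimal one
    (∀ γθ : SelPolicy S, ∃ γu : CtrlPolicy S, ∀ k < T, IsCertaintyEquivalent N T k γu γθ) ∧
    (∀ (γu : CtrlPolicy S) (γθ : SelPolicy S),
      (∀ γu' : CtrlPolicy S, cost N T γu γθ ≤ cost N T γu' γθ) ↔
        ∀ k < T, IsCertaintyEquivalent N T k γu γθ) ∧
    -- jointly optimal policies exist, and their control is certainty-equivalent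
    (∃ (γu : CtrlPolicy S) (γθ : SelPolicy S), ∀ (γu' : CtrlPolicy S) (γθ' : SelPolicy S),
      cost N T γu γθ ≤ cost N T γu' γθ') ∧
    (∀ (γu : CtrlPolicy S) (γθ : SelPolicy S),
      (∀ (γu' : CtrlPolicy S) (γθ' : SelPolicy S), cost N T γu γθ ≤ cost N T γu' γθ') →
        ∀ k < T, IsCertaintyEquivalent N T k γu γθ) ∧
    -- the dynamic programming equation, and the control that minimizes its right-hand side,
    -- whatever policies were used before time `k`
    (∀ k < T, ∀ (γu : CtrlPolicy S) (γθ : SelPolicy S),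
      IsLeast {v | ∃ (γu' : CtrlPolicy S) (γθ' : SelPolicy S),
        CtrlPolicy.AgreeBefore k γu γu' ∧ SelPolicy.AgreeBefore k γθ γθ' ∧
          v = bellman N T k γu' γθ'} (value N T k γu γθ) ∧
      ((∀ γu' : CtrlPolicy S, CtrlPolicy.AgreeBefore k γu γu' →
          bellman N T k γu γθ ≤ bellman N T k γu' γθ) ↔
        IsCertaintyEquivalent N T k γu γθ)) ∧
    -- the form of the value function
    (∀ k ≤ T, ∀ (γu : CtrlPolicy S) (γθ : SelPolicy S),
      value N T k γu γθ =
        ∫⁻ ω, ENNReal.ofReal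
            (state N γu γθ k ω ⬝ᵥ S.riccati T k *ᵥ state N γu γθ k ω) ∂μ
          + selValue N T k γu γθ + ENNReal.ofReal (residual S T k) ∧
      value N T k γu γθ ≠ ⊤ ∧
      IsLeast {v | ∃ (γu' : CtrlPolicy S) (γθ' : SelPolicy S),
        CtrlPolicy.AgreeBefore k γu γu' ∧ SelPolicy.AgreeBefore k γθ γθ' ∧
          v = costFrom N T k γu' γθ'} (value N T k γu γθ) ∧
      IsLeast {v | ∃ γθ' : SelPolicy S, SelPolicy.AgreeBefore k γθ γθ' ∧
        v = selCost N T k γu γθ'} (selValue N T k γu γθ) ∧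
      ∀ γu' : CtrlPolicy S, selValue N T k γu' γθ = selValue N T k γu γθ) := by
  refine ⟨fun k _ => S.riccati_posSemidef T k, fun k _ => S.ctrlWeight_posDef T k, fun γθ => ?_,
    fun γu γθ => cost_minimal_iff N T γu γθ, ?_, fun γu γθ h => ?_, fun k hk γu γθ => ?_,
    fun k hk γu γθ => ?_⟩
  · obtain ⟨γu, -, h⟩ :=
      exists_certaintyEquivalent N ⟨fun _ _ => 0, fun _ => measurable_const⟩ γθ T 0
    exact ⟨γu, fun k _ => h k k.zero_le⟩
  · obtain ⟨⟨γu, γθ, -, -, h⟩, hmin⟩ := isLeast_value N T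
      ⟨fun _ _ => 0, fun _ => measurable_const⟩ ⟨fun _ _ => 0, fun _ => measurable_const⟩ T.zero_le
    exact ⟨γu, γθ, fun γu' γθ' => h.symm.trans_le (hmin ⟨γu', γθ',
      fun _ ht => absurd ht (Nat.not_lt_zero _), fun _ ht => absurd ht (Nat.not_lt_zero _), rfl⟩)⟩
  · exact (cost_minimal_iff N T γu γθ).1 fun γu' => h γu' γθ
  · exact ⟨isLeast_bellman N T γu γθ hk, bellman_minimal_iff N T γu γθ hk⟩
  · exact ⟨value_eq N T γu γθ hk, value_ne_top N T γu γθ hk, isLeast_value N T γu γθ hk,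
      isLeast_selValue N T γu γθ k, fun γu' => selValue_congr N T γu' γθ γu k⟩
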